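/- Let $d\ge 1$ and $0\le p<1/(2d)$. Let $\mu_p$ be the i.i.d. Bernoulli field on $\Omega=\{0,1\}^{\mathbb Z^d}$ with occupation probability $p$, and let $T:\Omega\to\Omega$ be the removal of isolated occupied sites: $(T\omega)_x=1$ if and only if $\omega_x=1$ and $\omega_y=1$ for some nearest neighbour $y$ of $x$. Let $\mu'_p=\mu_p\circ T^{-1}$ be the image measure and $\Omega'=T(\Omega)$. A specification is a family $\gamma=(\gamma_\Lambda)$, indexed by the finite sets $\Lambda\subset\mathbb Z^d$, of probability kernels $\gamma_\Lambda(\cdot\,|\,\omega)$ on $\Omega$ that depend on $\omega$ only through $\omega_{\Lambda^c}$, are proper ($\gamma_\Lambda(\cdot\,|\,\omega)$ is supported on the configurations that equal $\omega$ outside $\Lambda$) and consistent ($\gamma_\Delta\gamma_\Lambda=\gamma_\Delta$ for $\Lambda\subset\Delta$). Then there is a specification $\gamma'$ such that: 1. $\gamma'$ is a specification for $\mu'_p$: $\mu'_p\gamma'_\Lambda=\mu'_p$ for all finite $\Lambda$. 2. $\gamma'$ is quasilocal: for every finite $\Lambda$ and every pattern $\sigma_\Lambda\in\{0,1\}^\Lambda$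 the map $\omega\mapsto\gamma'_\Lambda(\sigma_\Lambda\,|\,\omega)$ is continuous on $\Omega$ in the product topology. 3. $\gamma'$ respects the non-isolation constraint: $\gamma'_\Lambda(\Omega'\,|\,\omega')=1$ for all finite $\Lambda$ and all $\omega'\in\Omega'$. 4. The continuity is exponential: there are constants $C,c>0$ such that for all finite $\Lambda\subset\Delta$, all $\omega',\tilde\omega'\in\Omega$ with $\omega'_\Delta=\tilde\omega'_\Delta$ and all $\sigma_\Lambda\in\{0,1\}^\Lambda$, $$|\gamma'_\Lambda(\sigma_\Lambda\,|\,\omega')-\gamma'_\Lambda(\sigma_\Lambda\,|\,\tilde\omega')|\le C\,|\Lambda|\,e^{-c\,\mathrm{dist}(\Lambda,\Delta^c)},$$ where $\mathrm{dist}$ is the $\ell^\infty$ distance. -/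

import Mathlib

open MeasureTheory ProbabilityTheory

namespace NonIsolates

/-- The sites of the lattice `ℤ^d`. The `dist` that Mathlib puts on this type is the
`ℓ^∞` metric. -/
abbrev Site (d : ℕ) : Type := Fin d → ℤ

/-- Configurations `{0,1}^{ℤ^d}` (`true` is occupied, `false` is empty), with the product
topology and the product `σ`-algebra. -/
abbrev Config (d : ℕ) : Type := Site d → Bool

/-- Nearest neighbours in `ℤ^d`: the `ℓ^1` distance is one. -/
def Adj {d : ℕ} (x y : Site d) : Prop := ∑ i, |x i - y i| = 1

open Classical in
/-- The projection to the non-isolates: a site is occupied in the image iff it is occupied and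
has an occupied nearest neighbour. -/
noncomputable def proj {d : ℕ} (ω : Config d) : Config d :=
  fun x => ω x && decide (∃ y, Adj x y ∧ ω y = true)

lemma measurable_proj {d : ℕ} : Measurable (proj : Config d → Config d) := by
  classical
  refine measurable_pi_lambda _ fun x => ?_
  refine measurable_to_bool ?_
  have h : (fun ω : Config d => proj ω x) ⁻¹' {true} =
      {ω | ω x = true} ∩ ⋃ y : Site d, {ω | Adj x y ∧ ω y = true} := by
    ext ω
    simp [proj]
  rw [h]
  have hm : ∀ y : Site d, MeasurableSet {ω : Config d | ω y = true} := fun y =>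
    (measurable_pi_apply (X := fun _ : Site d => Bool) y) (measurableSet_singleton true)
  refine (hm x).inter (MeasurableSet.iUnion fun y => ?_)
  exact (MeasurableSet.const (Adj x y)).inter (hm y)

/-- The i.i.d. Bernoulli field `μ_p`: every site is occupied with probability `p`,
independently. -/
noncomputable def bernoulliField (d : ℕ) (p : unitInterval) : Measure (Config d) :=
  Measure.infinitePi fun _ : Site d => bernoulliMeasure true false p

/-- The image measure `μ'_p = μ_p ∘ T⁻¹` of the Bernoulli field under the projection to the
non-isolates. -/
noncomputable def imageField (d : ℕ) (p : unitInterval) : Measure (Config d) :=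
  (bernoulliField d p).map proj

/-- The configurations that agree with `σ` on the finite volume `Λ`. -/
def pattern {d : ℕ} (Λ : Finset (Site d)) (σ : Config d) : Set (Config d) :=
  {τ | ∀ x ∈ Λ, τ x = σ x}

/-- A specification: a consistent and proper family of probability kernels `γ_Λ(· | ω)`,
indexed by the finite volumes `Λ`, which depend on `ω` through its restriction to the complement
of `Λ` only. -/
structure Specification (d : ℕ) where
  ker : Finset (Site d) → Kernel (Config d) (Config d)
  isMarkovKernel : ∀ Λ, IsMarkovKernel (ker Λ)
  congr_outside : ∀ (Λ : Finset (Site d)) (ω η : Config d),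
    (∀ x ∉ Λ, ω x = η x) → ker Λ ω = ker Λ η
  proper : ∀ (Λ : Finset (Site d)) (ω : Config d), ∀ᵐ τ ∂(ker Λ ω), ∀ x ∉ Λ, τ x = ω x
  consistent : ∀ Λ Δ : Finset (Site d), Λ ⊆ Δ → ker Λ ∘ₖ ker Δ = ker Δ

/-- Quasilocality: the probability of every pattern in a finite volume is a continuous function
of the boundary condition, in the product topology. -/
def Specification.IsQuasilocal {d : ℕ} (γ : Specification d) : Prop :=
  ∀ (Λ : Finset (Site d)) (σ : Config d), Continuous fun ω => γ.ker Λ ω (pattern Λ σ)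

/-- `γ` is a specification for the random field `μ`: the DLR equations `μ γ_Λ = μ`. -/
def Specification.IsSpecificationFor {d : ℕ} (γ : Specification d) (μ : Measure (Config d)) :
    Prop :=
  ∀ Λ : Finset (Site d), γ.ker Λ ∘ₘ μ = μ

/-- The `ℓ^∞` distance between the finite volume `Λ` and the complement of `Δ`. -/
noncomputable def distCompl {d : ℕ} (Λ Δ : Finset (Site d)) : ℝ :=
  sInf {r : ℝ | ∃ x ∈ Λ, ∃ y ∉ Δ, r = dist x y}

end NonIsolates

open NonIsolates

namespace NonIsolates

/-! ### Decay of correlations in the hard-core lattice gas -/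

section HardCore

open scoped Classical

variable {d : ℕ}

/-! In a finite box `B` with empty exterior, the Bernoulli configurations with a given non-isolated
image `σ` are `σ` plus an arbitrary independent set of sites of `B` that are empty and have only
empty neighbours in `σ` (`sum_pow_card_core_eq`). Summing out these erased isolates with fugacity `r
= p / (1 - p)` gives `σ` a weight proportional to `r ^ |σ|` times the hard-core partition function
of `vacant σ B`. A change of `σ` inside `Λ` alters the vacant set only in `halo Λ`, so relative
weights reduce to probabilities that a hard-core gas leaves `halo Λ` empty
(`log_hardCore_vacant_sub`).

These probabilities feel distant changes of the volume exponentially little, whatever the shape of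
the volume. The recursion `emptyProb_singleton_of_mem` removes a site and passes to its neighbours;
after the first step one neighbour is always missing, so a step contracts by `(2d - 1) r`, and `(2d
- 1) r < 1` is exactly `p < 1 / (2d)`. Hence the relative potential `pot` exists as a limit and is
exponentially local (`abs_pot_sub_le`).

A specification must also be defined for boundary conditions that force isolated sites. The weights
are therefore restricted to the minimizers of a finite-range energy that penalizes isolates.
Minimization is a local condition, so continuity survives, and the cocycle property of energy
differences gives consistency (`gibbs_mul_sum`). For a boundary condition without isolates, the
minimizers have none either (`IsGround.mem_range`).

For the DLR equations, the law of the projected field in `B` is exactly the finite-volume Gibbs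
distribution with empty boundary condition (`IsGibbsLaw`); consistency holds there, and `B` tends to
the lattice by dominated convergence (`integral_gibbsAvg_proj`). At `p = 0` an extra energy per
occupied site makes the empty configuration the only minimizer with empty boundary condition. -/

lemma Adj.symm {x y : Site d} (h : Adj x y) : Adj y x := by
  unfold Adj at *
  rw [← h]
  exact Finset.sum_congr rfl fun i _ => abs_sub_comm _ _

lemma Adj.irrefl (x : Site d) : ¬ Adj x x := by simp [Adj]

lemma dist_le_natCast_iff {x y : Site d} {n : ℕ} : dist x y ≤ n ↔ ∀ i, |x i - y i| ≤ n := by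
  rw [dist_pi_le_iff (by positivity)]
  simp only [Int.dist_eq]
  norm_cast

lemma Adj.dist_le {x y : Site d} (h : Adj x y) : dist x y ≤ 1 := by
  have := (dist_le_natCast_iff (x := x) (y := y) (n := 1)).2 fun i => by
    unfold Adj at h
    rw [Nat.cast_one, ← h]
    exact Finset.single_le_sum (f := fun i => |x i - y i|) (fun _ _ => abs_nonneg _)
      (Finset.mem_univ i)
  simpa using this

/-- The set of nearest neighbours. -/
def nbr (x : Site d) : Finset (Site d) :=
  Finset.univ.image fun q : Fin d × Bool => x + Pi.single q.1 (if q.2 then 1 else -1)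

lemma card_nbr_le (x : Site d) : (nbr x).card ≤ 2 * d := by
  refine Finset.card_image_le.trans ?_
  simp [mul_comm]

lemma mem_nbr {x y : Site d} : y ∈ nbr x ↔ Adj x y := by
  constructor
  · intro h
    obtain ⟨⟨j, b⟩, -, rfl⟩ := Finset.mem_image.1 h
    unfold Adj
    rw [Finset.sum_eq_single j]
    · cases b <;> simp
    · intro i _ hi
      simp [Pi.single_eq_of_ne hi]
    · simp
  · intro h
    have h' : ∑ i, |x i - y i| = 1 := h
    obtain ⟨j, hj⟩ : ∃ j, x j - y j ≠ 0 := by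
      by_contra! hc
      simp [hc] at h'
    rw [← Finset.add_sum_erase _ _ (Finset.mem_univ j)] at h'
    have h1 : 1 ≤ |x j - y j| := Int.one_le_abs hj
    have h2 : 0 ≤ ∑ i ∈ Finset.univ.erase j, |x i - y i| :=
      Finset.sum_nonneg fun _ _ => abs_nonneg _
    have h3 : ∑ i ∈ Finset.univ.erase j, |x i - y i| = 0 := by omega
    rw [Finset.sum_eq_zero_iff_of_nonneg fun _ _ => abs_nonneg _] at h3
    have h4 : |x j - y j| = 1 := by omega
    refine Finset.mem_image.2 ⟨(j, decide (y j - x j = 1)), Finset.mem_univ _, ?_⟩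
    funext i
    by_cases hi : i = j
    · subst hi
      rcases abs_cases (x i - y i) with hc | hc
      · have : ¬ (y i - x i = 1) := by omega
        simp [this]; omega
      · have : y i - x i = 1 := by omega
        simp [this]; omega
    · have := h3 i (Finset.mem_erase.2 ⟨hi, Finset.mem_univ _⟩)
      rw [abs_eq_zero] at this
      simp [Pi.single_eq_of_ne hi]; omega

/-- Independent (pairwise non-adjacent) sets of sites. -/
def Indep (I : Finset (Site d)) : Prop := ∀ x ∈ I, ∀ y ∈ I, ¬ Adj x y

/-- The partition function of the hard-core lattice gas with fugacity `r` in the volume `S`. -/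
noncomputable def hardCore (r : ℝ) (S : Finset (Site d)) : ℝ :=
  ∑ I ∈ S.powerset with Indep I, r ^ I.card

lemma one_le_hardCore {r : ℝ} (hr : 0 ≤ r) (S : Finset (Site d)) : 1 ≤ hardCore r S := by
  have h : (∅ : Finset (Site d)) ∈ S.powerset.filter Indep := by simp [Indep]
  have := Finset.single_le_sum (f := fun I : Finset (Site d) => r ^ I.card)
    (fun _ _ => by positivity) h
  simpa [hardCore] using this

lemma hardCore_pos {r : ℝ} (hr : 0 ≤ r) (S : Finset (Site d)) : 0 < hardCore r S :=
  zero_lt_one.trans_le (one_le_hardCore hr S)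

lemma indep_insert_iff {x : Site d} {I : Finset (Site d)} :
    Indep (insert x I) ↔ Indep I ∧ Disjoint I (nbr x) := by
  rw [Finset.disjoint_left]
  simp only [Indep, Finset.mem_insert, mem_nbr]
  constructor
  · intro h
    exact ⟨fun a ha b hb => h a (.inr ha) b (.inr hb), fun a ha => h x (.inl rfl) a (.inr ha)⟩
  · rintro ⟨h1, h2⟩ a (rfl | ha) b (rfl | hb)
    · exact Adj.irrefl _
    · exact h2 hb
    · exact fun h => h2 ha h.symm
    · exact h1 a ha b hb

/-- Independent sets are split according to whether they contain `x`; those that do avoid its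
neighbours. -/
lemma hardCore_eq_erase_add (r : ℝ) {S : Finset (Site d)} {x : Site d} (hx : x ∈ S) :
    hardCore r S = hardCore r (S.erase x) + r * hardCore r (S.erase x \ nbr x) := by
  conv_lhs => rw [← Finset.insert_erase hx]
  unfold hardCore
  rw [Finset.sum_filter, Finset.sum_powerset_insert (Finset.notMem_erase x S), ← Finset.sum_filter,
    ← Finset.sum_filter, Finset.mul_sum]
  congr 1
  refine Finset.sum_congr ?_ ?_
  · ext I
    simp only [Finset.mem_filter, Finset.mem_powerset, indep_insert_iff, Finset.subset_sdiff]
    tauto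
  · intro I hI
    have : x ∉ I := fun h => Finset.notMem_erase x S
      ((Finset.mem_powerset.1 (Finset.mem_filter.1 hI).1 |>.trans Finset.sdiff_subset) h)
    rw [Finset.card_insert_of_notMem this, pow_succ, mul_comm]

lemma hardCore_mono {r : ℝ} (hr : 0 ≤ r) {S S' : Finset (Site d)} (h : S ⊆ S') :
    hardCore r S ≤ hardCore r S' := by
  refine Finset.sum_le_sum_of_subset_of_nonneg ?_ fun _ _ _ => by positivity
  exact Finset.filter_subset_filter _ (Finset.powerset_mono.2 h)

/-- The probability that the hard-core gas in `S` leaves `A` empty. -/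
noncomputable def emptyProb (r : ℝ) (S A : Finset (Site d)) : ℝ :=
  hardCore r (S \ A) / hardCore r S

lemma emptyProb_pos {r : ℝ} (hr : 0 ≤ r) (S A : Finset (Site d)) : 0 < emptyProb r S A :=
  div_pos (hardCore_pos hr _) (hardCore_pos hr _)

lemma emptyProb_le_one {r : ℝ} (hr : 0 ≤ r) (S A : Finset (Site d)) : emptyProb r S A ≤ 1 :=
  (div_le_one (hardCore_pos hr _)).2 (hardCore_mono hr Finset.sdiff_subset)

/-- Chain rule: conditioned on `A` being empty, the gas in `S` is the gas in `S \ A`. It reduces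
every estimate to single sites. -/
lemma emptyProb_insert {r : ℝ} (hr : 0 ≤ r) (S A : Finset (Site d)) (x : Site d) :
    emptyProb r S (insert x A) = emptyProb r S A * emptyProb r (S \ A) {x} := by
  unfold emptyProb
  have h1 := (hardCore_pos hr S).ne'
  have h2 := (hardCore_pos hr (S \ A)).ne'
  have h3 : S \ insert x A = (S \ A) \ {x} := by grind
  rw [h3]
  field_simp

lemma emptyProb_empty {r : ℝ} (hr : 0 ≤ r) (S : Finset (Site d)) : emptyProb r S ∅ = 1 := by
  simp [emptyProb, (hardCore_pos hr S).ne']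

lemma emptyProb_singleton_of_mem {r : ℝ} (hr : 0 ≤ r) {S : Finset (Site d)} {x : Site d}
    (hx : x ∈ S) : emptyProb r S {x} = 1 / (1 + r * emptyProb r (S.erase x) (nbr x)) := by
  have h1 := hardCore_pos hr (S.erase x)
  have h2 := hardCore_pos hr (S.erase x \ nbr x)
  unfold emptyProb
  rw [hardCore_eq_erase_add r hx, Finset.sdiff_singleton_eq_erase]
  field_simp

lemma emptyProb_singleton_of_notMem {r : ℝ} (hr : 0 ≤ r) {S : Finset (Site d)} {x : Site d}
    (hx : x ∉ S) : emptyProb r S {x} = 1 := by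
  simp [emptyProb, Finset.sdiff_singleton_eq_erase, Finset.erase_eq_of_notMem hx,
    (hardCore_pos hr S).ne']

lemma le_emptyProb_singleton {r : ℝ} (hr : 0 ≤ r) (S : Finset (Site d)) (x : Site d) :
    1 / (1 + r) ≤ emptyProb r S {x} := by
  by_cases hx : x ∈ S
  · rw [emptyProb_singleton_of_mem hr hx]
    have h1 := emptyProb_pos hr (S.erase x) (nbr x)
    have h2 := emptyProb_le_one hr (S.erase x) (nbr x)
    have h3 : r * emptyProb r (S.erase x) (nbr x) ≤ r * 1 := by gcongr
    apply one_div_le_one_div_of_le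
    · positivity
    · linarith
  · rw [emptyProb_singleton_of_notMem hr hx, div_le_one (by positivity)]
    linarith

lemma abs_one_div_one_add_sub_le {a b : ℝ} (ha : 0 ≤ a) (hb : 0 ≤ b) :
    |1 / (1 + a) - 1 / (1 + b)| ≤ |a - b| := by
  have : 1 / (1 + a) - 1 / (1 + b) = (b - a) / ((1 + a) * (1 + b)) := by field_simp; ring
  rw [this, abs_div, abs_sub_comm b a, abs_of_pos (by positivity : 0 < (1 + a) * (1 + b))]
  apply div_le_self (abs_nonneg _)
  nlinarith [mul_nonneg ha hb]

/-- The chain rule writes both sides as products of factors in `[0, 1]`, so the errors of the single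
factors add up. -/
lemma abs_emptyProb_sub_le {r ε : ℝ} (hr : 0 ≤ r) (S S' A : Finset (Site d))
    (h : ∀ x ∈ A, ∀ B ⊆ A, |emptyProb r (S \ B) {x} - emptyProb r (S' \ B) {x}| ≤ ε) :
    |emptyProb r S A - emptyProb r S' A| ≤ A.card * ε := by
  induction A using Finset.induction_on with
  | empty => simp [emptyProb_empty hr]
  | insert x A hx ih =>
    have ih' := ih fun y hy B hB => h y (Finset.mem_insert_of_mem hy) B
      (hB.trans (Finset.subset_insert _ _))
    have h1 := h x (Finset.mem_insert_self _ _) A (Finset.subset_insert _ _)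
    rw [emptyProb_insert hr, emptyProb_insert hr, Finset.card_insert_of_notMem hx]
    set a := emptyProb r S A
    set a' := emptyProb r S' A
    set b := emptyProb r (S \ A) {x}
    set b' := emptyProb r (S' \ A) {x}
    have hb : |b| ≤ 1 := by
      rw [abs_of_pos (emptyProb_pos hr _ _)]; exact emptyProb_le_one hr _ _
    have ha : |a'| ≤ 1 := by
      rw [abs_of_pos (emptyProb_pos hr _ _)]; exact emptyProb_le_one hr _ _
    calc |a * b - a' * b'| = |(a - a') * b + a' * (b - b')| := by ring_nf
      _ ≤ |a - a'| * |b| + |a'| * |b - b'| := by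
        rw [← abs_mul, ← abs_mul]; exact abs_add_le _ _
      _ ≤ |a - a'| * 1 + 1 * |b - b'| := by gcongr
      _ ≤ _ := by push_cast; linarith

/-- One step of the recursion, using that `t ↦ 1 / (1 + t)` is 1-Lipschitz for `t ≥ 0`. The set `A`
stands for the neighbours that really count: all of them at the root, all but one later. -/
lemma abs_emptyProb_singleton_sub_le {r ε : ℝ} (hr : 0 ≤ r) {S S' : Finset (Site d)} {x : Site d}
    (hε : 0 ≤ ε) {A : Finset (Site d)} (hx : x ∈ S ↔ x ∈ S')
    (hA : x ∈ S → emptyProb r (S.erase x) (nbr x) = emptyProb r (S.erase x) A)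
    (hA' : x ∈ S' → emptyProb r (S'.erase x) (nbr x) = emptyProb r (S'.erase x) A)
    (h : ∀ z ∈ A, ∀ B ⊆ A,
      |emptyProb r (S.erase x \ B) {z} - emptyProb r (S'.erase x \ B) {z}| ≤ ε) :
    |emptyProb r S {x} - emptyProb r S' {x}| ≤ r * (A.card * ε) := by
  by_cases hxS : x ∈ S
  · have hxS' := hx.1 hxS
    rw [emptyProb_singleton_of_mem hr hxS, emptyProb_singleton_of_mem hr hxS', hA hxS, hA' hxS']
    refine (abs_one_div_one_add_sub_le (mul_nonneg hr (emptyProb_pos hr _ _).le)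
      (mul_nonneg hr (emptyProb_pos hr _ _).le)).trans ?_
    rw [← mul_sub, abs_mul, abs_of_nonneg hr]
    exact mul_le_mul_of_nonneg_left (abs_emptyProb_sub_le hr _ _ _ h) hr
  · rw [emptyProb_singleton_of_notMem hr hxS, emptyProb_singleton_of_notMem hr (mt hx.2 hxS)]
    simp only [sub_self, abs_zero]
    positivity

/-- One step of the tree recursion contracts by `(2d - 1) r`, as soon as one of the neighbours of
the root is missing. -/
lemma abs_emptyProb_singleton_sub_le_pow {r ρ : ℝ} (hr : 0 ≤ r) (hρ : 0 ≤ ρ)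
    (hrρ : (2 * d - 1) * r ≤ ρ) (n : ℕ) :
    ∀ (S S' : Finset (Site d)) (x y : Site d), Adj x y → y ∉ S → y ∉ S' →
      (∀ z, dist x z ≤ n → (z ∈ S ↔ z ∈ S')) →
      |emptyProb r S {x} - emptyProb r S' {x}| ≤ ρ ^ n := by
  induction n with
  | zero =>
    intro S S' x y _ _ _ _
    rw [pow_zero, abs_sub_le_iff]
    have h1 := emptyProb_pos hr S {x}
    have h2 := emptyProb_le_one hr S {x}
    have h3 := emptyProb_pos hr S' {x}
    have h4 := emptyProb_le_one hr S' {x}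
    constructor <;> linarith
  | succ n ih =>
    intro S S' x y hxy hy hy' hS
    have key : ∀ T : Finset (Site d), y ∉ T → emptyProb r (T.erase x) (nbr x) =
        emptyProb r (T.erase x) ((nbr x).erase y) := by
      intro T hT
      unfold emptyProb
      congr 2
      ext z
      simp only [Finset.mem_sdiff, Finset.mem_erase]
      grind
    refine (abs_emptyProb_singleton_sub_le (ε := ρ ^ n) hr (by positivity) (A := (nbr x).erase y)
      (hS x (by simp; positivity)) (fun _ => key S hy) (fun _ => key S' hy') ?_).trans ?_
    · intro z hz B _
      have hz' : Adj x z := mem_nbr.1 (Finset.mem_of_mem_erase hz)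
      -- The site `x` has just been erased, so it is the missing neighbour of `z` in the next step.
      refine ih _ _ z x hz'.symm (by simp) (by simp) fun w hw => ?_
      have : dist x w ≤ ((n + 1 : ℕ) : ℝ) := by
        push_cast
        linarith [dist_triangle x z w, hz'.dist_le]
      simp [hS w this]
    · have hc : (((nbr x).erase y).card : ℝ) ≤ 2 * d - 1 := by
        rw [Finset.card_erase_of_mem (mem_nbr.2 hxy)]
        have h0 : 0 < (nbr x).card := Finset.card_pos.2 ⟨y, mem_nbr.2 hxy⟩
        rw [Nat.cast_sub h0]
        have : ((nbr x).card : ℝ) ≤ 2 * d := by exact_mod_cast card_nbr_le x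
        push_cast
        linarith
      calc r * (((nbr x).erase y).card * ρ ^ n) ≤ r * ((2 * d - 1) * ρ ^ n) := by gcongr
        _ = ((2 * d - 1) * r) * ρ ^ n := by ring
        _ ≤ ρ * ρ ^ n := by gcongr
        _ = ρ ^ (n + 1) := by ring

/-- The root may have all `2d` neighbours, so its step need not contract and only contributes the
factor `2 * d`. -/
lemma abs_emptyProb_singleton_sub_le_mul_pow {r ρ : ℝ} (hr : 0 ≤ r) (hr1 : r ≤ 1) (hρ : 0 ≤ ρ)
    (hrρ : (2 * d - 1) * r ≤ ρ) (n : ℕ) (S S' : Finset (Site d)) (x : Site d)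
    (hS : ∀ z, dist x z ≤ (n + 1 : ℕ) → (z ∈ S ↔ z ∈ S')) :
    |emptyProb r S {x} - emptyProb r S' {x}| ≤ 2 * d * ρ ^ n := by
  refine (abs_emptyProb_singleton_sub_le (ε := ρ ^ n) hr (by positivity) (A := nbr x)
      (hS x (by simp; positivity)) (fun _ => rfl) (fun _ => rfl) ?_).trans ?_
  · intro z hz B _
    have hz' : Adj x z := mem_nbr.1 hz
    refine abs_emptyProb_singleton_sub_le_pow hr hρ hrρ n _ _ z x hz'.symm (by simp) (by simp)
      fun w hw => ?_
    have : dist x w ≤ ((n + 1 : ℕ) : ℝ) := by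
      push_cast
      linarith [dist_triangle x z w, hz'.dist_le]
    simp [hS w this]
  · have hc : ((nbr x).card : ℝ) ≤ 2 * d := by exact_mod_cast card_nbr_le x
    calc r * ((nbr x).card * ρ ^ n) ≤ 1 * (2 * d * ρ ^ n) := by gcongr
      _ = _ := one_mul _

lemma abs_log_sub_log_le {a b : ℝ} (ha : 1 / 2 ≤ a) (hb : 1 / 2 ≤ b) :
    |Real.log a - Real.log b| ≤ 2 * |a - b| := by
  wlog hab : b ≤ a generalizing a b
  · rw [abs_sub_comm, abs_sub_comm a]
    exact this hb ha (le_of_not_ge hab)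
  have hb0 : 0 < b := by linarith
  have ha0 : 0 < a := by linarith
  rw [abs_of_nonneg (sub_nonneg.2 (Real.log_le_log hb0 hab)), abs_of_nonneg (sub_nonneg.2 hab),
    ← Real.log_div ha0.ne' hb0.ne']
  refine (Real.log_le_sub_one_of_pos (by positivity)).trans ?_
  rw [div_sub_one hb0.ne', div_le_iff₀ hb0]
  nlinarith

/-- For `r ≤ 1` each factor of the chain rule is at least `1 / 2`, where the logarithm is
2-Lipschitz. -/
lemma abs_log_emptyProb_sub_le {r ρ : ℝ} (hr : 0 ≤ r) (hr1 : r ≤ 1) (hρ : 0 ≤ ρ)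
    (hrρ : (2 * d - 1) * r ≤ ρ) (n : ℕ) (S S' A : Finset (Site d))
    (hS : ∀ x ∈ A, ∀ z, dist x z ≤ (n + 1 : ℕ) → (z ∈ S ↔ z ∈ S')) :
    |Real.log (emptyProb r S A) - Real.log (emptyProb r S' A)| ≤ A.card * (4 * d * ρ ^ n) := by
  induction A using Finset.induction_on with
  | empty => simp [emptyProb_empty hr]
  | insert x A hx ih =>
    have ih' := ih fun y hy => hS y (Finset.mem_insert_of_mem hy)
    have h1 : |emptyProb r (S \ A) {x} - emptyProb r (S' \ A) {x}| ≤ 2 * d * ρ ^ n :=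
      abs_emptyProb_singleton_sub_le_mul_pow hr hr1 hρ hrρ n _ _ x fun z hz => by
        simp [hS x (Finset.mem_insert_self _ _) z hz]
    have hhalf : ∀ T : Finset (Site d), 1 / 2 ≤ emptyProb r T {x} := fun T =>
      (one_div_le_one_div_of_le (by positivity) (by linarith)).trans (le_emptyProb_singleton hr T x)
    have h2 := abs_log_sub_log_le (hhalf (S \ A)) (hhalf (S' \ A))
    rw [emptyProb_insert hr, emptyProb_insert hr, Finset.card_insert_of_notMem hx,
      Real.log_mul (emptyProb_pos hr _ _).ne' (emptyProb_pos hr _ _).ne',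
      Real.log_mul (emptyProb_pos hr _ _).ne' (emptyProb_pos hr _ _).ne', add_sub_add_comm]
    refine (abs_add_le _ _).trans ?_
    push_cast
    linarith

end HardCore

end NonIsolates

namespace NonIsolates

/-! ### Gibbs weights on the minimizers of a cocycle -/

section Gibbs

open scoped Classical

variable {d : ℕ}

/-- The configuration that is `σ` in `Λ` and `ω` outside. -/
def glue (Λ : Finset (Site d)) (σ ω : Config d) : Config d :=
  fun x => if x ∈ Λ then σ x else ω x

/-- The indicator configuration of a finite set. -/
noncomputable def ind (s : Finset (Site d)) : Config d := fun x => decide (x ∈ s)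

/-- The configurations that agree with `ω` outside `Λ`. -/
noncomputable def fiber (Λ : Finset (Site d)) (ω : Config d) : Finset (Config d) :=
  Λ.powerset.image fun s => glue Λ (ind s) ω

lemma glue_of_mem {Λ : Finset (Site d)} {σ ω : Config d} {x : Site d} (h : x ∈ Λ) :
    glue Λ σ ω x = σ x := if_pos h

lemma glue_of_notMem {Λ : Finset (Site d)} {σ ω : Config d} {x : Site d} (h : x ∉ Λ) :
    glue Λ σ ω x = ω x := if_neg h

lemma mem_fiber {Λ : Finset (Site d)} {τ ω : Config d} :
    τ ∈ fiber Λ ω ↔ ∀ x ∉ Λ, τ x = ω x := by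
  constructor
  · intro h x hx
    obtain ⟨s, -, rfl⟩ := Finset.mem_image.1 h
    exact glue_of_notMem hx
  · intro h
    refine Finset.mem_image.2 ⟨Λ.filter fun x => τ x = true, by simp, ?_⟩
    funext x
    by_cases hx : x ∈ Λ
    · simp [glue_of_mem hx, ind, hx]
    · rw [glue_of_notMem hx, h x hx]

lemma glue_mem_fiber (Λ : Finset (Site d)) (σ ω : Config d) : glue Λ σ ω ∈ fiber Λ ω :=
  mem_fiber.2 fun _ => glue_of_notMem

lemma self_mem_fiber (Λ : Finset (Site d)) (ω : Config d) : ω ∈ fiber Λ ω :=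
  mem_fiber.2 fun _ _ => rfl

lemma fiber_congr {Λ : Finset (Site d)} {τ ω : Config d} (h : τ ∈ fiber Λ ω) :
    fiber Λ τ = fiber Λ ω := by
  ext υ
  simp only [mem_fiber] at *
  exact forall₂_congr fun x hx => by rw [h x hx]

lemma mem_fiber_comm {Λ : Finset (Site d)} {τ ω : Config d} :
    τ ∈ fiber Λ ω ↔ ω ∈ fiber Λ τ := by
  simp only [mem_fiber, eq_comm]

lemma fiber_mono {Λ Δ : Finset (Site d)} (h : Λ ⊆ Δ) (ω : Config d) : fiber Λ ω ⊆ fiber Δ ω :=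
  fun _ hτ => mem_fiber.2 fun x hx => mem_fiber.1 hτ x fun hx' => hx (h hx')

lemma sum_fiber {M : Type*} [AddCommMonoid M] (Λ : Finset (Site d)) (ω : Config d)
    (F : Config d → M) :
    ∑ τ ∈ fiber Λ ω, F τ = ∑ s ∈ Λ.powerset, F (glue Λ (ind s) ω) := by
  refine Finset.sum_image fun s hs t ht hst => ?_
  have hs' : s ⊆ Λ := by simpa using hs
  have ht' : t ⊆ Λ := by simpa using ht
  ext x
  by_cases hx : x ∈ Λ
  · have := congrFun hst x
    simpa [glue_of_mem hx, ind] using this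
  · exact iff_of_false (fun h => hx (hs' h)) (fun h => hx (ht' h))

lemma sum_fiber_comm {M : Type*} [AddCommMonoid M] {Λ Δ : Finset (Site d)} (h : Λ ⊆ Δ)
    (ω : Config d) (F : Config d → Config d → M) :
    ∑ τ ∈ fiber Δ ω, ∑ υ ∈ fiber Λ τ, F τ υ = ∑ υ ∈ fiber Δ ω, ∑ τ ∈ fiber Λ υ, F τ υ := by
  refine Finset.sum_comm' fun τ υ => ?_
  constructor
  · rintro ⟨h1, h2⟩
    exact ⟨mem_fiber_comm.1 h2, fiber_congr h1 ▸ fiber_mono h _ h2⟩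
  · rintro ⟨h1, h2⟩
    exact ⟨fiber_congr h2 ▸ fiber_mono h _ h1, mem_fiber_comm.1 h1⟩

/-- Additive cocycles on the relation of agreement outside a finite volume. -/
def IsCocycle {G : Type*} [AddCommGroup G] (Φ : Config d → Config d → G) : Prop :=
  ∀ (Λ : Finset (Site d)) (σ τ υ : Config d), τ ∈ fiber Λ σ → υ ∈ fiber Λ σ →
    Φ σ τ + Φ τ υ = Φ σ υ

lemma IsCocycle.self {G : Type*} [AddCommGroup G] {Φ : Config d → Config d → G}
    (h : IsCocycle Φ) (σ : Config d) : Φ σ σ = 0 := by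
  have := h ∅ σ σ σ (self_mem_fiber _ _) (self_mem_fiber _ _)
  simpa using this

lemma IsCocycle.symm {G : Type*} [AddCommGroup G] {Φ : Config d → Config d → G}
    (h : IsCocycle Φ) {Λ : Finset (Site d)} {σ τ : Config d} (hτ : τ ∈ fiber Λ σ) :
    Φ τ σ = - Φ σ τ := by
  have := h Λ σ τ σ hτ (self_mem_fiber _ _)
  rw [h.self] at this
  exact (neg_eq_of_add_eq_zero_right this).symm

/-- `σ` minimizes the energy `D` among the configurations that agree with it outside `Λ`. -/
def IsGround (D : Config d → Config d → ℤ) (Λ : Finset (Site d)) (σ : Config d) : Prop :=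
  ∀ τ ∈ fiber Λ σ, 0 ≤ D τ σ

/-- The partition function over the ground states in `Λ`, relative to `σ`. -/
noncomputable def groundSum (D : Config d → Config d → ℤ) (Φ : Config d → Config d → ℝ)
    (Λ : Finset (Site d)) (σ : Config d) : ℝ :=
  ∑ τ ∈ fiber Λ σ, if D τ σ = 0 then Real.exp (Φ τ σ) else 0

/-- The Gibbs weights of the cocycle `Φ`, restricted to the minimizers of `D`. -/
noncomputable def gibbs (D : Config d → Config d → ℤ) (Φ : Config d → Config d → ℝ)
    (Λ : Finset (Site d)) (σ : Config d) : ℝ :=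
  if IsGround D Λ σ then (groundSum D Φ Λ σ)⁻¹ else 0

variable {D : Config d → Config d → ℤ} {Φ : Config d → Config d → ℝ}

lemma groundSum_nonneg (Λ : Finset (Site d)) (σ : Config d) : 0 ≤ groundSum D Φ Λ σ :=
  Finset.sum_nonneg fun _ _ => by split_ifs <;> positivity

lemma groundSum_pos (hD : IsCocycle D) (Λ : Finset (Site d)) (σ : Config d) :
    0 < groundSum D Φ Λ σ := by
  refine Finset.sum_pos' (fun _ _ => by split_ifs <;> positivity) ⟨σ, self_mem_fiber _ _, ?_⟩
  rw [if_pos (hD.self σ)]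
  positivity

lemma gibbs_nonneg (Λ : Finset (Site d)) (σ : Config d) : 0 ≤ gibbs D Φ Λ σ := by
  unfold gibbs
  split_ifs
  · exact inv_nonneg.2 (groundSum_nonneg _ _)
  · exact le_rfl

lemma IsGround.eq_zero_iff (hD : IsCocycle D) {Λ : Finset (Site d)} {σ τ : Config d}
    (hσ : IsGround D Λ σ) (hτ : τ ∈ fiber Λ σ) : IsGround D Λ τ ↔ D τ σ = 0 := by
  constructor
  · intro h
    have h1 := h σ (mem_fiber_comm.1 hτ)
    have h2 := hσ τ hτ
    have h3 := hD.symm hτ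
    omega
  · intro h υ hυ
    rw [fiber_congr hτ] at hυ
    have h1 := hD Λ υ σ τ (mem_fiber_comm.1 hυ) (fiber_congr hυ ▸ hτ)
    have h2 := hD.symm hτ
    have h3 := hσ υ hυ
    omega

lemma groundSum_eq_mul (hD : IsCocycle D) (hΦ : IsCocycle Φ) {Λ : Finset (Site d)}
    {σ τ : Config d} (hτ : τ ∈ fiber Λ σ) (h : D τ σ = 0) :
    groundSum D Φ Λ σ = Real.exp (Φ τ σ) * groundSum D Φ Λ τ := by
  unfold groundSum
  rw [fiber_congr hτ, Finset.mul_sum]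
  refine Finset.sum_congr rfl fun υ hυ => ?_
  have h1 := hD Λ υ τ σ (fiber_congr hυ ▸ hτ) (mem_fiber_comm.1 hυ)
  have h2 := hΦ Λ υ τ σ (fiber_congr hυ ▸ hτ) (mem_fiber_comm.1 hυ)
  rw [h, add_zero] at h1
  rw [h1, ← h2]
  split_ifs
  · rw [← Real.exp_add, add_comm]
  · simp

lemma gibbs_of_isGround (hD : IsCocycle D) (hΦ : IsCocycle Φ) {Λ : Finset (Site d)}
    {σ τ : Config d} (hσ : IsGround D Λ σ) (hτ : τ ∈ fiber Λ σ) :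
    gibbs D Φ Λ τ = gibbs D Φ Λ σ * if D τ σ = 0 then Real.exp (Φ τ σ) else 0 := by
  unfold gibbs
  rw [if_pos hσ]
  simp only [hσ.eq_zero_iff hD hτ]
  split_ifs with h
  · rw [groundSum_eq_mul hD hΦ hτ h, mul_inv, mul_comm, ← mul_assoc,
      mul_inv_cancel₀ (Real.exp_pos _).ne', one_mul]
  · simp

lemma exists_isGround (hD : IsCocycle D) (Λ : Finset (Site d)) (ω : Config d) :
    ∃ σ ∈ fiber Λ ω, IsGround D Λ σ := by
  obtain ⟨σ, hσ, h⟩ := Finset.exists_min_image (fiber Λ ω) (fun τ => D τ ω)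
    ⟨ω, self_mem_fiber _ _⟩
  refine ⟨σ, hσ, fun τ hτ => ?_⟩
  rw [fiber_congr hσ] at hτ
  have h1 := hD Λ τ σ ω (fiber_congr hτ ▸ hσ) (mem_fiber_comm.1 hτ)
  have h2 := h τ hτ
  omega

lemma sum_gibbs (hD : IsCocycle D) (hΦ : IsCocycle Φ) (Λ : Finset (Site d)) (ω : Config d) :
    ∑ τ ∈ fiber Λ ω, gibbs D Φ Λ τ = 1 := by
  obtain ⟨σ, hσ, h⟩ := exists_isGround hD Λ ω
  rw [← fiber_congr hσ, Finset.sum_congr rfl fun τ hτ => gibbs_of_isGround hD hΦ h hτ,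
    ← Finset.mul_sum]
  change gibbs D Φ Λ σ * groundSum D Φ Λ σ = 1
  unfold gibbs
  rw [if_pos h, inv_mul_cancel₀ (groundSum_pos hD _ _).ne']

/-- Consistency at the level of weights: a minimizer in `Δ` is one in `Λ`, and conditioning the
weights of `Δ` on the exterior of `Λ` gives those of `Λ`. -/
lemma gibbs_mul_sum (hD : IsCocycle D) (hΦ : IsCocycle Φ) {Λ Δ : Finset (Site d)} (hΛ : Λ ⊆ Δ)
    (υ : Config d) :
    gibbs D Φ Λ υ * ∑ τ ∈ fiber Λ υ, gibbs D Φ Δ τ = gibbs D Φ Δ υ := by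
  by_cases h : IsGround D Δ υ
  · have h' : IsGround D Λ υ := fun τ hτ => h τ (fiber_mono hΛ _ hτ)
    rw [Finset.sum_congr rfl fun τ hτ => gibbs_of_isGround hD hΦ h (fiber_mono hΛ _ hτ),
      ← Finset.mul_sum]
    change gibbs D Φ Λ υ * (gibbs D Φ Δ υ * groundSum D Φ Λ υ) = _
    rw [gibbs, if_pos h', mul_comm, mul_assoc, mul_inv_cancel₀ (groundSum_pos hD _ _).ne', mul_one]
  · rw [show gibbs D Φ Δ υ = 0 from if_neg h]
    by_cases h' : IsGround D Λ υ
    · rw [Finset.sum_eq_zero, mul_zero]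
      intro τ hτ
      -- Since `υ` minimizes in `Λ`, its energy is at most that of `τ`; if `τ` minimized in `Δ`, so
      -- would `υ`.
      refine if_neg fun hg => h fun κ hκ => ?_
      have hτ' := fiber_mono hΛ _ hτ
      have h1 := hg κ (fiber_congr hτ' ▸ hκ)
      have h2 := h' τ hτ
      have h3 := hD Δ κ τ υ (fiber_congr hκ ▸ hτ') (mem_fiber_comm.1 hκ)
      omega
    · rw [show gibbs D Φ Λ υ = 0 from if_neg h', zero_mul]

lemma gibbs_le_one (hD : IsCocycle D) (hΦ : IsCocycle Φ) (Λ : Finset (Site d)) (σ : Config d) :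
    gibbs D Φ Λ σ ≤ 1 := by
  rw [← sum_gibbs hD hΦ Λ σ]
  exact Finset.single_le_sum (fun τ _ => gibbs_nonneg Λ τ) (self_mem_fiber Λ σ)

/-- The expectation of `f` under the Gibbs weights in `Λ`. -/
noncomputable def gibbsAvg (D : Config d → Config d → ℤ) (Φ : Config d → Config d → ℝ)
    (Λ : Finset (Site d)) (f : Config d → ℝ) (ω : Config d) : ℝ :=
  ∑ τ ∈ fiber Λ ω, gibbs D Φ Λ τ * f τ

lemma gibbsAvg_gibbsAvg (hD : IsCocycle D) (hΦ : IsCocycle Φ) {Λ Δ : Finset (Site d)}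
    (hΛ : Λ ⊆ Δ) (f : Config d → ℝ) (ω : Config d) :
    gibbsAvg D Φ Δ (gibbsAvg D Φ Λ f) ω = gibbsAvg D Φ Δ f ω := by
  unfold gibbsAvg
  simp only [Finset.mul_sum]
  rw [sum_fiber_comm hΛ]
  refine Finset.sum_congr rfl fun υ _ => ?_
  rw [← gibbs_mul_sum hD hΦ hΛ υ, Finset.mul_sum, Finset.sum_mul]
  exact Finset.sum_congr rfl fun τ _ => by ring

lemma abs_gibbsAvg_le (hD : IsCocycle D) (hΦ : IsCocycle Φ) (Λ : Finset (Site d))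
    {f : Config d → ℝ} {M : ℝ} (hf : ∀ τ, |f τ| ≤ M) (ω : Config d) :
    |gibbsAvg D Φ Λ f ω| ≤ M := by
  calc |gibbsAvg D Φ Λ f ω| ≤ ∑ τ ∈ fiber Λ ω, |gibbs D Φ Λ τ * f τ| :=
        Finset.abs_sum_le_sum_abs _ _
    _ ≤ ∑ τ ∈ fiber Λ ω, gibbs D Φ Λ τ * M := by
        refine Finset.sum_le_sum fun τ _ => ?_
        rw [abs_mul, abs_of_nonneg (gibbs_nonneg Λ τ)]
        exact mul_le_mul_of_nonneg_left (hf τ) (gibbs_nonneg Λ τ)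
    _ = M := by rw [← Finset.sum_mul, sum_gibbs hD hΦ, one_mul]

lemma isGround_iff_powerset {Λ : Finset (Site d)} {σ : Config d} :
    IsGround D Λ σ ↔ ∀ s ∈ Λ.powerset, 0 ≤ D (glue Λ (ind s) σ) σ := by
  simp [IsGround, fiber]

lemma groundSum_eq_powerset (Λ : Finset (Site d)) (σ : Config d) :
    groundSum D Φ Λ σ = ∑ s ∈ Λ.powerset,
      if D (glue Λ (ind s) σ) σ = 0 then Real.exp (Φ (glue Λ (ind s) σ) σ) else 0 :=
  sum_fiber _ _ _

open Filter Topology in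
-- Integer energy differences are eventually constant, so the set of minimizers freezes and only a
-- finite sum of exponentials has to converge.
lemma tendsto_gibbs {ι : Type*} {l : Filter ι} {Ψ : ι → Config d → Config d → ℝ}
    {ζ : ι → Config d} {σ : Config d} {Λ : Finset (Site d)} (hD : IsCocycle D)
    (h1 : ∀ s ∈ Λ.powerset, ∀ᶠ i in l, D (glue Λ (ind s) (ζ i)) (ζ i) = D (glue Λ (ind s) σ) σ)
    (h2 : ∀ s ∈ Λ.powerset, Tendsto (fun i => Ψ i (glue Λ (ind s) (ζ i)) (ζ i)) l
      (𝓝 (Φ (glue Λ (ind s) σ) σ))) :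
    Tendsto (fun i => gibbs D (Ψ i) Λ (ζ i)) l (𝓝 (gibbs D Φ Λ σ)) := by
  rw [← Filter.eventually_all_finset] at h1
  have h3 : Tendsto (fun i => if IsGround D Λ σ then (∑ s ∈ Λ.powerset,
      if D (glue Λ (ind s) σ) σ = 0 then Real.exp (Ψ i (glue Λ (ind s) (ζ i)) (ζ i)) else 0)⁻¹
      else 0) l (𝓝 (gibbs D Φ Λ σ)) := by
    unfold gibbs
    split_ifs with h
    · refine Tendsto.inv₀ ?_ (groundSum_pos hD _ _).ne'
      rw [groundSum_eq_powerset]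
      refine tendsto_finsetSum _ fun s hs => ?_
      split_ifs
      · exact (Real.continuous_exp.tendsto _).comp (h2 s hs)
      · exact tendsto_const_nhds
    · exact tendsto_const_nhds
  refine h3.congr' ?_
  filter_upwards [h1] with i hi
  have e1 : IsGround D Λ (ζ i) ↔ IsGround D Λ σ := by
    rw [isGround_iff_powerset, isGround_iff_powerset]
    exact forall₂_congr fun s hs => by rw [hi s hs]
  unfold gibbs
  rw [groundSum_eq_powerset]
  simp only [e1]
  congr 2
  exact Finset.sum_congr rfl fun s hs => by rw [hi s hs]

lemma inv_sub_inv_le {a b δ : ℝ} (hδ : 0 ≤ δ) (ha : 1 ≤ a) (hb : 0 < b) (h : b ≤ Real.exp δ * a) :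
    a⁻¹ - b⁻¹ ≤ δ := by
  have ha0 : 0 < a := by linarith
  have h1 : Real.exp (-δ) * a⁻¹ ≤ b⁻¹ := by
    rw [Real.exp_neg, ← mul_inv]
    exact inv_anti₀ hb h
  have h2 : 1 - δ ≤ Real.exp (-δ) := by linarith [Real.add_one_le_exp (-δ)]
  have h3 : a⁻¹ ≤ 1 := inv_le_one_of_one_le₀ ha
  have h4 : 0 < a⁻¹ := inv_pos.2 ha0
  nlinarith

lemma one_le_groundSum (hD : IsCocycle D) (hΦ : IsCocycle Φ) (Λ : Finset (Site d))
    (σ : Config d) : 1 ≤ groundSum D Φ Λ σ := by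
  have := Finset.single_le_sum
    (f := fun τ => if D τ σ = 0 then Real.exp (Φ τ σ) else 0)
    (fun τ _ => by split_ifs <;> positivity) (self_mem_fiber Λ σ)
  unfold groundSum
  simpa only [hD.self, hΦ.self, if_true, Real.exp_zero] using this

/-- The two partition functions agree up to a factor `exp δ`. Each is at least `1`, being taken
relative to its own configuration, so the inverses differ by at most `δ`, with no dependence on the
number of configurations. -/
lemma abs_gibbs_sub_le (hD : IsCocycle D) (hΦ : IsCocycle Φ) {Λ : Finset (Site d)}
    {σ τ : Config d} {δ : ℝ} (hδ : 0 ≤ δ)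
    (h1 : ∀ s ∈ Λ.powerset, D (glue Λ (ind s) σ) σ = D (glue Λ (ind s) τ) τ)
    (h2 : ∀ s ∈ Λ.powerset,
      |Φ (glue Λ (ind s) σ) σ - Φ (glue Λ (ind s) τ) τ| ≤ δ) :
    |gibbs D Φ Λ σ - gibbs D Φ Λ τ| ≤ δ := by
  have e1 : IsGround D Λ σ ↔ IsGround D Λ τ := by
    rw [isGround_iff_powerset, isGround_iff_powerset]
    exact forall₂_congr fun s hs => by rw [h1 s hs]
  have key : ∀ {σ τ : Config d},
      (∀ s ∈ Λ.powerset, D (glue Λ (ind s) σ) σ = D (glue Λ (ind s) τ) τ) →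
      (∀ s ∈ Λ.powerset, |Φ (glue Λ (ind s) σ) σ - Φ (glue Λ (ind s) τ) τ| ≤ δ) →
      groundSum D Φ Λ σ ≤ Real.exp δ * groundSum D Φ Λ τ := by
    intro σ τ h1 h2
    rw [groundSum_eq_powerset, groundSum_eq_powerset, Finset.mul_sum]
    refine Finset.sum_le_sum fun s hs => ?_
    rw [h1 s hs]
    split_ifs
    · rw [← Real.exp_add]
      exact Real.exp_le_exp.2 (by linarith [(abs_le.1 (h2 s hs)).2])
    · simp
  unfold gibbs
  rw [← e1]
  split_ifs
  · rw [abs_sub_le_iff]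
    exact ⟨inv_sub_inv_le hδ (one_le_groundSum hD hΦ _ _) (groundSum_pos hD _ _)
        (key (fun s hs => (h1 s hs).symm) fun s hs => by rw [abs_sub_comm]; exact h2 s hs),
      inv_sub_inv_le hδ (one_le_groundSum hD hΦ _ _) (groundSum_pos hD _ _) (key h1 h2)⟩
  · simpa using hδ

/-! ### From weights to kernels -/

lemma measurable_glue (Λ : Finset (Site d)) (σ : Config d) : Measurable (glue Λ σ) := by
  refine measurable_pi_lambda _ fun x => ?_
  by_cases hx : x ∈ Λ
  · simp [glue, hx]
  · simpa [glue, hx] using measurable_pi_apply x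

lemma continuous_glue (Λ : Finset (Site d)) (σ : Config d) : Continuous (glue Λ σ) := by
  refine continuous_pi fun x => ?_
  by_cases hx : x ∈ Λ
  · simpa [glue, hx] using continuous_const
  · simpa [glue, hx] using continuous_apply x

/-- The Gibbs distribution in `Λ` as a measure on configurations. -/
noncomputable def gibbsMeasure (D : Config d → Config d → ℤ) (Φ : Config d → Config d → ℝ)
    (Λ : Finset (Site d)) (ω : Config d) : Measure (Config d) :=
  ∑ τ ∈ fiber Λ ω, ENNReal.ofReal (gibbs D Φ Λ τ) • Measure.dirac τ

lemma gibbsMeasure_apply (Λ : Finset (Site d)) (ω : Config d) {s : Set (Config d)}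
    (hs : MeasurableSet s) :
    gibbsMeasure D Φ Λ ω s =
      ∑ τ ∈ fiber Λ ω, ENNReal.ofReal (gibbs D Φ Λ τ) * s.indicator 1 τ := by
  simp [gibbsMeasure, Measure.finsetSum_apply, Measure.dirac_apply' _ hs]

lemma lintegral_gibbsMeasure (Λ : Finset (Site d)) (ω : Config d) (f : Config d → ENNReal) :
    ∫⁻ τ, f τ ∂gibbsMeasure D Φ Λ ω =
      ∑ τ ∈ fiber Λ ω, ENNReal.ofReal (gibbs D Φ Λ τ) * f τ := by
  simp [gibbsMeasure, lintegral_smul_measure]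

lemma integral_gibbsMeasure (Λ : Finset (Site d)) (ω : Config d) (f : Config d → ℝ) :
    ∫ τ, f τ ∂gibbsMeasure D Φ Λ ω = gibbsAvg D Φ Λ f ω := by
  unfold gibbsMeasure gibbsAvg
  rw [integral_finsetSum_measure]
  · simp [integral_smul_measure, ENNReal.toReal_ofReal (gibbs_nonneg _ _)]
  · intro τ _
    exact (integrable_dirac (by simp)).smul_measure (by simp)

lemma measurable_gibbsMeasure {Λ : Finset (Site d)} (h : Measurable (gibbs D Φ Λ)) :
    Measurable (gibbsMeasure D Φ Λ) := by
  refine Measure.measurable_of_measurable_coe _ fun s hs => ?_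
  simp only [gibbsMeasure_apply _ _ hs]
  simp only [sum_fiber]
  refine Finset.measurable_sum _ fun t _ => ?_
  have hg := measurable_glue Λ (ind t)
  exact (h.comp hg).ennreal_ofReal.mul ((measurable_one.indicator hs).comp hg)

lemma gibbsMeasure_univ (hD : IsCocycle D) (hΦ : IsCocycle Φ) (Λ : Finset (Site d))
    (ω : Config d) : gibbsMeasure D Φ Λ ω Set.univ = 1 := by
  rw [gibbsMeasure_apply _ _ MeasurableSet.univ]
  simp only [Set.indicator_univ, Pi.one_apply, mul_one]
  rw [← ENNReal.ofReal_sum_of_nonneg fun _ _ => gibbs_nonneg _ _, sum_gibbs hD hΦ,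
    ENNReal.ofReal_one]

lemma ae_gibbsMeasure {Λ : Finset (Site d)} {ω : Config d} {P : Config d → Prop}
    (h : ∀ τ ∈ fiber Λ ω, IsGround D Λ τ → P τ) : ∀ᵐ τ ∂gibbsMeasure D Φ Λ ω, P τ := by
  rw [ae_iff]
  simp only [gibbsMeasure, Measure.finsetSum_apply, Measure.smul_apply, smul_eq_mul,
    Finset.sum_eq_zero_iff, Measure.dirac_apply]
  intro τ hτ
  by_cases hg : IsGround D Λ τ
  · simp [h τ hτ hg]
  · simp [gibbs, hg]

/-- The specification with Gibbs weights `gibbs D Φ`. -/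
noncomputable def gibbsSpec (hD : IsCocycle D) (hΦ : IsCocycle Φ)
    (hm : ∀ Λ, Measurable (gibbs D Φ Λ)) : Specification d where
  ker Λ := ⟨gibbsMeasure D Φ Λ, measurable_gibbsMeasure (hm Λ)⟩
  isMarkovKernel Λ := ⟨fun ω => ⟨gibbsMeasure_univ hD hΦ Λ ω⟩⟩
  congr_outside Λ ω η h := by
    change gibbsMeasure D Φ Λ ω = gibbsMeasure D Φ Λ η
    unfold gibbsMeasure
    rw [fiber_congr (mem_fiber.2 h)]
  proper Λ ω := ae_gibbsMeasure fun τ hτ _ => mem_fiber.1 hτ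
  consistent Λ Δ h := by
    ext ω s hs
    rw [Kernel.comp_apply' _ _ _ hs]
    change ∫⁻ τ, gibbsMeasure D Φ Λ τ s ∂gibbsMeasure D Φ Δ ω = gibbsMeasure D Φ Δ ω s
    rw [lintegral_gibbsMeasure, gibbsMeasure_apply _ _ hs]
    simp only [gibbsMeasure_apply _ _ hs, Finset.mul_sum]
    rw [sum_fiber_comm h]
    refine Finset.sum_congr rfl fun υ _ => ?_
    rw [← gibbs_mul_sum hD hΦ h υ, ENNReal.ofReal_mul (gibbs_nonneg _ _),
      ENNReal.ofReal_sum_of_nonneg fun _ _ => gibbs_nonneg _ _, Finset.mul_sum, Finset.sum_mul]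
    exact Finset.sum_congr rfl fun τ _ => by ring

lemma measurableSet_pattern (Λ : Finset (Site d)) (σ : Config d) :
    MeasurableSet (pattern Λ σ) := by
  have : pattern Λ σ = ⋂ x ∈ Λ, (fun τ : Config d => τ x) ⁻¹' {σ x} := by
    ext; simp [pattern]
  rw [this]
  exact Finset.measurableSet_biInter _ fun x _ => measurable_pi_apply x (measurableSet_singleton _)

lemma gibbsMeasure_pattern (Λ : Finset (Site d)) (σ ω : Config d) :
    gibbsMeasure D Φ Λ ω (pattern Λ σ) = ENNReal.ofReal (gibbs D Φ Λ (glue Λ σ ω)) := by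
  rw [gibbsMeasure_apply _ _ (measurableSet_pattern _ _),
    Finset.sum_eq_single_of_mem (glue Λ σ ω) (glue_mem_fiber _ _ _)]
  · have : glue Λ σ ω ∈ pattern Λ σ := fun x hx => glue_of_mem hx
    simp [this]
  · intro τ hτ hne
    rw [Set.indicator_of_notMem, mul_zero]
    intro hp
    refine hne (funext fun x => ?_)
    by_cases hx : x ∈ Λ
    · rw [glue_of_mem hx, hp x hx]
    · rw [glue_of_notMem hx, mem_fiber.1 hτ x hx]

end Gibbs

end NonIsolates

namespace NonIsolates

/-! ### The energy that penalizes isolated sites -/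

section Potential

open scoped Classical
open Filter Topology

variable {d : ℕ}

/-- All neighbours of `x` are empty in `σ`. -/
def EmptyAround (σ : Config d) (x : Site d) : Prop := ∀ y, Adj x y → σ y = false

lemma proj_eq_true_iff {ω : Config d} {x : Site d} :
    proj ω x = true ↔ ω x = true ∧ ∃ y, Adj x y ∧ ω y = true := by
  simp [proj]

lemma mem_range_proj_iff {ω : Config d} :
    ω ∈ Set.range (proj : Config d → Config d) ↔
      ∀ x, ω x = true → ∃ y, Adj x y ∧ ω y = true := by
  constructor
  · rintro ⟨η, rfl⟩ x hx
    obtain ⟨h1, y, hy, h2⟩ := proj_eq_true_iff.1 hx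
    exact ⟨y, hy, proj_eq_true_iff.2 ⟨h2, x, hy.symm, h1⟩⟩
  · intro h
    refine ⟨ω, funext fun x => ?_⟩
    rw [Bool.eq_iff_iff, proj_eq_true_iff]
    exact ⟨fun h => h.1, fun hx => ⟨hx, h x hx⟩⟩

lemma mem_range_proj_iff_not_emptyAround {ω : Config d} :
    ω ∈ Set.range (proj : Config d → Config d) ↔ ∀ x, ω x = true → ¬ EmptyAround ω x := by
  rw [mem_range_proj_iff]
  simp [EmptyAround]

/-- The sites at graph distance at most one from `Λ`. -/
def halo (Λ : Finset (Site d)) : Finset (Site d) := Λ ∪ Λ.biUnion nbr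

lemma mem_halo {Λ : Finset (Site d)} {x : Site d} :
    x ∈ halo Λ ↔ x ∈ Λ ∨ ∃ y ∈ Λ, Adj y x := by
  simp [halo, mem_nbr]

lemma subset_halo (Λ : Finset (Site d)) : Λ ⊆ halo Λ := Finset.subset_union_left

lemma card_halo_le (Λ : Finset (Site d)) : (halo Λ).card ≤ (2 * d + 1) * Λ.card := by
  refine (Finset.card_union_le _ _).trans ?_
  have := Finset.card_biUnion_le_card_mul Λ nbr (2 * d) fun x _ => card_nbr_le x
  linarith

lemma exists_dist_le_of_mem_halo {Λ : Finset (Site d)} {x : Site d} (h : x ∈ halo Λ) :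
    ∃ y ∈ Λ, dist y x ≤ 1 := by
  rcases mem_halo.1 h with h | ⟨y, hy, h⟩
  · exact ⟨x, h, by simp⟩
  · exact ⟨y, hy, h.dist_le⟩

lemma emptyAround_congr {σ τ : Config d} {x : Site d} (h : ∀ y, Adj x y → σ y = τ y) :
    EmptyAround σ x ↔ EmptyAround τ x :=
  forall₂_congr fun y hy => by rw [h y hy]

lemma emptyAround_congr_of_mem_fiber {Λ : Finset (Site d)} {σ τ : Config d} {x : Site d}
    (h : τ ∈ fiber Λ σ) (hx : x ∉ halo Λ) : EmptyAround σ x ↔ EmptyAround τ x :=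
  emptyAround_congr fun y hy => (mem_fiber.1 h y fun hy' =>
    hx (mem_halo.2 (.inr ⟨y, hy', hy.symm⟩))).symm

/-- Every occupied site costs `k`, and an isolated one costs `2` more. -/
noncomputable def energy (k : ℤ) (σ : Config d) (x : Site d) : ℤ :=
  if σ x = true then (if EmptyAround σ x then k + 2 else k) else 0

/-- The energy difference of two configurations that differ in finitely many sites. -/
noncomputable def energyDiff (k : ℤ) (σ τ : Config d) : ℤ :=
  ∑ᶠ x, (energy k σ x - energy k τ x)

lemma support_energy_sub (k : ℤ) {Λ : Finset (Site d)} {σ τ : Config d} (h : τ ∈ fiber Λ σ) :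
    (Function.support fun x => energy k σ x - energy k τ x) ⊆ halo Λ := by
  intro x hx
  by_contra hx'
  refine hx ?_
  have h1 := emptyAround_congr_of_mem_fiber h hx'
  have h2 := mem_fiber.1 h x fun h => hx' (subset_halo Λ h)
  simp [energy, h1, h2]

lemma energyDiff_eq_sum (k : ℤ) {Λ : Finset (Site d)} {σ τ : Config d} (h : τ ∈ fiber Λ σ) :
    energyDiff k σ τ = ∑ x ∈ halo Λ, (energy k σ x - energy k τ x) :=
  finsum_eq_sum_of_support_subset _ (support_energy_sub k h)

lemma isCocycle_energyDiff (k : ℤ) : IsCocycle (energyDiff (d := d) k) := by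
  intro Λ σ τ υ hτ hυ
  rw [energyDiff_eq_sum k hτ, energyDiff_eq_sum k hυ,
    energyDiff_eq_sum k (fiber_congr hτ ▸ hυ : υ ∈ fiber Λ τ), ← Finset.sum_add_distrib]
  exact Finset.sum_congr rfl fun x _ => by ring

lemma energy_congr (k : ℤ) {σ τ : Config d} {x : Site d} (hx : σ x = τ x)
    (h : ∀ y, Adj x y → σ y = τ y) : energy k σ x = energy k τ x := by
  simp [energy, hx, emptyAround_congr h]

lemma energyDiff_congr (k : ℤ) {Λ : Finset (Site d)} {σ τ σ' τ' : Config d} (h : τ ∈ fiber Λ σ)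
    (h' : τ' ∈ fiber Λ σ') (hσ : ∀ x ∈ halo (halo Λ), σ x = σ' x)
    (hτ : ∀ x ∈ halo (halo Λ), τ x = τ' x) : energyDiff k σ τ = energyDiff k σ' τ' := by
  rw [energyDiff_eq_sum k h, energyDiff_eq_sum k h']
  refine Finset.sum_congr rfl fun x hx => ?_
  have h1 := subset_halo _ hx
  have h2 : ∀ y, Adj x y → y ∈ halo (halo Λ) := fun y hy => mem_halo.2 (.inr ⟨x, hx, hy⟩)
  rw [energy_congr k (hσ x h1) fun y hy => hσ y (h2 y hy),
    energy_congr k (hτ x h1) fun y hy => hτ y (h2 y hy)]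

/-- For one-site moves: a gain of two at `x` outweighs a smaller loss at `y`. The case `y = x` is
allowed, since the remaining sum then no longer contains `y`. -/
lemma energyDiff_neg {k : ℤ} {Λ : Finset (Site d)} {σ τ : Config d} (h : τ ∈ fiber Λ σ)
    {x y : Site d} (hx : energy k σ x - energy k τ x ≤ -2)
    (hy : energy k σ y - energy k τ y < 2)
    (hle : ∀ z, z ≠ x → z ≠ y → energy k σ z ≤ energy k τ z) : energyDiff k σ τ < 0 := by
  have hxm : x ∈ halo Λ := support_energy_sub k h (by
    simp only [Function.mem_support]; omega)
  rw [energyDiff_eq_sum k h, ← Finset.add_sum_erase _ _ hxm]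
  have : ∑ z ∈ (halo Λ).erase x, (energy k σ z - energy k τ z) < 2 := by
    calc _ ≤ ∑ z ∈ (halo Λ).erase x, if z = y then (energy k σ z - energy k τ z) else 0 := by
          refine Finset.sum_le_sum fun z hz => ?_
          split_ifs with hzy
          · exact le_rfl
          · linarith [hle z (Finset.ne_of_mem_erase hz) hzy]
      _ < 2 := by
          rw [Finset.sum_ite_eq']
          split_ifs <;> omega
  omega

lemma energy_update_true_le {k : ℤ} {σ : Config d} {y z : Site d} (hz : z ≠ y) :
    energy k (Function.update σ y true) z ≤ energy k σ z := by
  unfold energy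
  rw [Function.update_of_ne hz]
  have : EmptyAround (Function.update σ y true) z → EmptyAround σ z := by
    intro h w hw
    have := h w hw
    by_cases hwy : w = y
    · subst hwy; simp at this
    · rwa [Function.update_of_ne hwy] at this
  split_ifs <;> first | omega | tauto

/-- With a non-isolated boundary condition, the minimizers of the energy have no isolated sites. -/
lemma IsGround.mem_range {k : ℤ} (hk0 : 0 ≤ k) (hk : k < 2) {Λ : Finset (Site d)}
    {ω τ : Config d} (hω : ω ∈ Set.range (proj : Config d → Config d)) (hτ : τ ∈ fiber Λ ω)
    (h : IsGround (energyDiff k) Λ τ) : τ ∈ Set.range (proj : Config d → Config d) := by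
  rw [mem_range_proj_iff_not_emptyAround]
  intro x hx hiso
  by_cases hxΛ : x ∈ Λ
  -- An isolated site inside `Λ` can be emptied: this gains `k + 2` and isolates no other site.
  · have hmem : Function.update τ x false ∈ fiber Λ τ := mem_fiber.2 fun z hz =>
      Function.update_of_ne (ne_of_mem_of_not_mem hxΛ hz).symm _ _
    have hle : ∀ z, z ≠ x → energy k (Function.update τ x false) z ≤ energy k τ z := by
      intro z hz
      by_cases hτz : τ z = true
      · refine (energy_congr k (Function.update_of_ne hz _ _) fun w hw => ?_).le
        refine Function.update_of_ne (fun hwx => ?_) _ _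
        subst hwx
        simp [hiso z hw.symm] at hτz
      · simp [energy, Function.update_of_ne hz, hτz]
    have hEx : energy k (Function.update τ x false) x - energy k τ x ≤ -2 := by
      simp [energy, hx, hiso, hk0]
    exact absurd (h _ hmem) (not_le.2 (energyDiff_neg (mem_fiber_comm.1 hmem) hEx
      (hEx.trans_lt (by norm_num)) fun z hz _ => hle z hz))
  -- An isolated site outside `Λ` has a neighbour `y` occupied in `ω`, which must lie in `Λ`.
  -- Refilling `y` gains `2` at `x` and costs only `k < 2` at `y`.
  · have hωx : ω x = true := by rw [← mem_fiber.1 hτ x hxΛ, hx]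
    obtain ⟨y, hxy, hy⟩ := mem_range_proj_iff.1 hω x hωx
    have hτy := hiso y hxy
    have hyΛ : y ∈ Λ := by
      by_contra hyΛ
      rw [mem_fiber.1 hτ y hyΛ, hy] at hτy
      simp at hτy
    have hmem : Function.update τ y true ∈ fiber Λ τ := mem_fiber.2 fun z hz =>
      Function.update_of_ne (ne_of_mem_of_not_mem hyΛ hz).symm _ _
    have hne : y ≠ x := fun h => Adj.irrefl x (h ▸ hxy)
    have hnot : ¬ EmptyAround (Function.update τ y true) x := fun h => by simpa using h y hxy
    have hnot' : ¬ EmptyAround (Function.update τ y true) y := fun h => by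
      simpa [Function.update_of_ne hne.symm, hx] using h x hxy.symm
    refine absurd (h _ hmem) (not_le.2 (energyDiff_neg (mem_fiber_comm.1 hmem) (x := x) (y := y)
      ?_ ?_ fun z _ hz => energy_update_true_le hz))
    · simp [energy, Function.update_of_ne hne.symm, hx, hnot, hiso]
    · simp [energy, hnot', hτy, hk]

lemma energy_zero_nonneg (σ : Config d) (x : Site d) : 0 ≤ energy 0 σ x := by
  unfold energy
  split_ifs <;> simp

lemma energy_zero_eq_zero_of_mem_range {σ : Config d}
    (h : σ ∈ Set.range (proj : Config d → Config d)) (x : Site d) : energy 0 σ x = 0 := by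
  rw [mem_range_proj_iff_not_emptyAround] at h
  unfold energy
  split_ifs with h1 h2
  · exact absurd h2 (h x h1)
  · rfl
  · rfl

lemma isGround_zero_of_mem_range {σ : Config d} (h : σ ∈ Set.range (proj : Config d → Config d))
    (Λ : Finset (Site d)) : IsGround (energyDiff 0) Λ σ := by
  intro τ hτ
  refine finsum_nonneg fun x => ?_
  rw [energy_zero_eq_zero_of_mem_range h, sub_zero]
  exact energy_zero_nonneg _ _

lemma energyDiff_zero_eq_zero_iff {Λ : Finset (Site d)} {σ τ : Config d}
    (h : σ ∈ Set.range (proj : Config d → Config d)) (hτ : τ ∈ fiber Λ σ) :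
    energyDiff 0 τ σ = 0 ↔ τ ∈ Set.range (proj : Config d → Config d) := by
  rw [← (isGround_zero_of_mem_range h Λ).eq_zero_iff (isCocycle_energyDiff 0) hτ]
  exact ⟨fun hg => hg.mem_range le_rfl (by norm_num) h hτ,
    fun hr => isGround_zero_of_mem_range hr Λ⟩

/-! ### The relative potential and its locality -/

/-- The fugacity `r` satisfies the uniqueness condition of the hard-core gas with rate `ρ`. -/
structure Contracts (d : ℕ) (r ρ : ℝ) : Prop where
  nonneg : 0 ≤ r
  le_one : r ≤ 1
  rate_pos : 0 < ρ
  rate_lt_one : ρ < 1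
  le_rate : (2 * d - 1) * r ≤ ρ

/-- The sites of `B` that may carry an isolated occupied site which is erased in the image `σ`. -/
noncomputable def vacant (σ : Config d) (B : Finset (Site d)) : Finset (Site d) :=
  B.filter fun x => σ x = false ∧ EmptyAround σ x

/-- The logarithm of the unnormalized weight of the image configuration `σ` in the volume `B`. -/
noncomputable def finPot (a r : ℝ) (B : Finset (Site d)) (σ : Config d) : ℝ :=
  ((B.filter fun x => σ x = true).card : ℝ) * Real.log a + Real.log (hardCore r (vacant σ B))

/-- The relative potential of the image field, in infinite volume. -/
noncomputable def pot (a r : ℝ) (σ τ : Config d) : ℝ :=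
  limUnder atTop fun B : Finset (Site d) => finPot a r B σ - finPot a r B τ

lemma card_occupied_sub {Λ B : Finset (Site d)} (hB : Λ ⊆ B) {σ τ : Config d}
    (h : τ ∈ fiber Λ σ) :
    ((B.filter fun x => σ x = true).card : ℝ) - (B.filter fun x => τ x = true).card =
      ∑ x ∈ Λ, ((if σ x = true then 1 else 0) - (if τ x = true then 1 else 0)) := by
  rw [Finset.natCast_card_filter, Finset.natCast_card_filter, ← Finset.sum_sub_distrib]
  refine (Finset.sum_subset hB fun x _ hx => ?_).symm
  rw [mem_fiber.1 h x hx, sub_self]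

lemma vacant_sdiff_halo {Λ : Finset (Site d)} {σ τ : Config d} (h : τ ∈ fiber Λ σ)
    (B : Finset (Site d)) : vacant σ B \ halo Λ = vacant τ B \ halo Λ := by
  ext x
  simp only [vacant, Finset.mem_sdiff, Finset.mem_filter]
  refine and_congr_left fun hx => ?_
  rw [emptyAround_congr_of_mem_fiber h hx, mem_fiber.1 h x fun hx' => hx (subset_halo _ hx')]

lemma log_hardCore_vacant_sub {r : ℝ} (hr : 0 ≤ r) {Λ : Finset (Site d)} {σ τ : Config d}
    (h : τ ∈ fiber Λ σ) (B : Finset (Site d)) :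
    Real.log (hardCore r (vacant σ B)) - Real.log (hardCore r (vacant τ B)) =
      Real.log (emptyProb r (vacant τ B) (halo Λ)) -
        Real.log (emptyProb r (vacant σ B) (halo Λ)) := by
  unfold emptyProb
  rw [vacant_sdiff_halo h, Real.log_div (hardCore_pos hr _).ne' (hardCore_pos hr _).ne',
    Real.log_div (hardCore_pos hr _).ne' (hardCore_pos hr _).ne']
  ring

/-- The radius `n + 3` is one step from `Λ` to its halo, `n + 1` for the decay estimate, and one
more to see the neighbours that decide vacancy. -/
lemma abs_log_emptyProb_vacant_sub_le {r ρ : ℝ} (hc : Contracts d r ρ) (n : ℕ)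
    {Λ B B' : Finset (Site d)} {σ σ' : Config d}
    (hloc : ∀ x ∈ Λ, ∀ z, dist x z ≤ (n + 3 : ℕ) → z ∈ B ∧ z ∈ B' ∧ σ z = σ' z) :
    |Real.log (emptyProb r (vacant σ B) (halo Λ)) -
      Real.log (emptyProb r (vacant σ' B') (halo Λ))| ≤
        4 * d * (2 * d + 1) * Λ.card * ρ ^ n := by
  refine (abs_log_emptyProb_sub_le hc.nonneg hc.le_one hc.rate_pos.le hc.le_rate n _ _ _
    fun x hx z hz => ?_).trans ?_
  · obtain ⟨y, hy, hyx⟩ := exists_dist_le_of_mem_halo hx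
    push_cast at hz hloc
    obtain ⟨h1, h2, h3⟩ := hloc y hy z (by linarith [dist_triangle y x z])
    have h4 : EmptyAround σ z ↔ EmptyAround σ' z := emptyAround_congr fun w hw =>
      (hloc y hy w (by linarith [dist_triangle y x z, dist_triangle y z w, hw.dist_le])).2.2
    simp [vacant, h1, h2, h3, h4]
  · have : ((halo Λ).card : ℝ) ≤ (2 * d + 1) * Λ.card := by exact_mod_cast card_halo_le Λ
    have hρ := hc.rate_pos
    calc ((halo Λ).card : ℝ) * (4 * d * ρ ^ n) ≤ ((2 * d + 1) * Λ.card) * (4 * d * ρ ^ n) := by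
          gcongr
      _ = _ := by ring

/-- The constant in the locality estimate for the potential. -/
noncomputable def potConst (d : ℕ) : ℝ := 8 * d * (2 * d + 1)

lemma potConst_nonneg (d : ℕ) : 0 ≤ potConst d := by unfold potConst; positivity

lemma abs_finPot_sub_sub_le {a r ρ : ℝ} (hc : Contracts d r ρ) (n : ℕ)
    {Λ B B' : Finset (Site d)} {σ τ σ' τ' : Config d} (h : τ ∈ fiber Λ σ) (h' : τ' ∈ fiber Λ σ')
    (hloc : ∀ x ∈ Λ, ∀ z, dist x z ≤ (n + 3 : ℕ) →
      z ∈ B ∧ z ∈ B' ∧ σ z = σ' z ∧ τ z = τ' z) :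
    |(finPot a r B σ - finPot a r B τ) - (finPot a r B' σ' - finPot a r B' τ')| ≤
      potConst d * Λ.card * ρ ^ n := by
  have hself : ∀ x ∈ Λ, x ∈ B ∧ x ∈ B' ∧ σ x = σ' x ∧ τ x = τ' x := fun x hx =>
    hloc x hx x (by simp only [dist_self]; positivity)
  have e1 := card_occupied_sub (fun x hx => (hself x hx).1) h
  have e2 := card_occupied_sub (fun x hx => (hself x hx).2.1) h'
  have e3 : ∑ x ∈ Λ, ((if σ x = true then (1 : ℝ) else 0) - (if τ x = true then 1 else 0)) =
      ∑ x ∈ Λ, ((if σ' x = true then 1 else 0) - (if τ' x = true then 1 else 0)) :=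
    Finset.sum_congr rfl fun x hx => by rw [(hself x hx).2.2.1, (hself x hx).2.2.2]
  have e4 := log_hardCore_vacant_sub hc.nonneg h B
  have e5 := log_hardCore_vacant_sub hc.nonneg h' B'
  have h1 := abs_log_emptyProb_vacant_sub_le hc n (Λ := Λ) (B := B) (B' := B') (σ := σ)
    (σ' := σ') fun x hx z hz => by obtain ⟨h1, h2, h3, h4⟩ := hloc x hx z hz; exact ⟨h1, h2, h3⟩
  have h2 := abs_log_emptyProb_vacant_sub_le hc n (Λ := Λ) (B := B) (B' := B') (σ := τ)
    (σ' := τ') fun x hx z hz => by obtain ⟨h1, h2, h3, h4⟩ := hloc x hx z hz; exact ⟨h1, h2, h4⟩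
  have e6 : (finPot a r B σ - finPot a r B τ) - (finPot a r B' σ' - finPot a r B' τ') =
      (Real.log (emptyProb r (vacant τ B) (halo Λ)) -
        Real.log (emptyProb r (vacant τ' B') (halo Λ))) -
      (Real.log (emptyProb r (vacant σ B) (halo Λ)) -
        Real.log (emptyProb r (vacant σ' B') (halo Λ))) := by
    unfold finPot
    linear_combination Real.log a * (e1 - e2 + e3) + e4 - e5
  rw [e6]
  refine (abs_sub _ _).trans ?_
  unfold potConst
  linarith

/-- The sites within `ℓ^∞` distance `n` from `Λ`. -/
noncomputable def thicken (Λ : Finset (Site d)) (n : ℕ) : Finset (Site d) :=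
  Λ.biUnion fun x => Finset.Icc (fun i => x i - n) fun i => x i + n

lemma mem_thicken {Λ : Finset (Site d)} {n : ℕ} {z : Site d} :
    z ∈ thicken Λ n ↔ ∃ x ∈ Λ, dist x z ≤ n := by
  simp only [thicken, Finset.mem_biUnion, Finset.mem_Icc, Pi.le_def, dist_le_natCast_iff, abs_le,
    ← forall_and]
  refine exists_congr fun x => and_congr_right fun _ => forall_congr' fun i => ?_
  constructor <;> intro h <;> omega

lemma exists_mul_pow_lt {ρ : ℝ} (h0 : 0 < ρ) (h1 : ρ < 1) (K : ℝ) {ε : ℝ} (hε : 0 < ε) :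
    ∃ n : ℕ, K * ρ ^ n < ε := by
  have := (tendsto_pow_atTop_nhds_zero_of_lt_one h0.le h1).const_mul K
  rw [mul_zero] at this
  exact (this.eventually_lt_const hε).exists

/-- The locality estimate with equal configurations and different boxes is the Cauchy property. -/
lemma tendsto_finPot_sub {a r ρ : ℝ} (hc : Contracts d r ρ) {Λ : Finset (Site d)}
    {σ τ : Config d} (h : τ ∈ fiber Λ σ) :
    Tendsto (fun B : Finset (Site d) => finPot a r B σ - finPot a r B τ) atTop
      (𝓝 (pot a r σ τ)) := by
  refine CauchySeq.tendsto_limUnder (Metric.cauchySeq_iff.2 fun ε hε => ?_)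
  obtain ⟨n, hn⟩ := exists_mul_pow_lt hc.rate_pos hc.rate_lt_one (potConst d * Λ.card) hε
  refine ⟨thicken Λ (n + 3), fun B hB B' hB' => lt_of_le_of_lt ?_ hn⟩
  refine abs_finPot_sub_sub_le hc n h h fun x hx z hz => ?_
  have := mem_thicken.2 ⟨x, hx, hz⟩
  exact ⟨hB this, hB' this, rfl, rfl⟩

lemma isCocycle_pot {a r ρ : ℝ} (hc : Contracts d r ρ) : IsCocycle (pot (d := d) a r) := by
  intro Λ σ τ υ hτ hυ
  refine tendsto_nhds_unique (((tendsto_finPot_sub hc hτ).add (tendsto_finPot_sub hc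
    (fiber_congr hτ ▸ hυ : υ ∈ fiber Λ τ))).congr fun B => ?_) (tendsto_finPot_sub hc hυ)
  ring

lemma abs_pot_sub_le {a r ρ : ℝ} (hc : Contracts d r ρ) (n : ℕ) {Λ : Finset (Site d)}
    {σ τ σ' τ' : Config d} (h : τ ∈ fiber Λ σ) (h' : τ' ∈ fiber Λ σ')
    (hσ : ∀ z ∈ thicken Λ (n + 3), σ z = σ' z) (hτ : ∀ z ∈ thicken Λ (n + 3), τ z = τ' z) :
    |pot a r σ τ - pot a r σ' τ'| ≤ potConst d * Λ.card * ρ ^ n := by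
  refine le_of_tendsto ((tendsto_finPot_sub hc h).sub (tendsto_finPot_sub hc h')).abs ?_
  filter_upwards [eventually_ge_atTop (thicken Λ (n + 3))] with B hB
  refine abs_finPot_sub_sub_le hc n h h' fun x hx z hz => ?_
  have := mem_thicken.2 ⟨x, hx, hz⟩
  exact ⟨hB this, hB this, hσ z this, hτ z this⟩

lemma halo_halo_subset_thicken (Λ : Finset (Site d)) (n : ℕ) :
    halo (halo Λ) ⊆ thicken Λ (n + 3) := by
  intro z hz
  obtain ⟨y, hy, hyz⟩ := exists_dist_le_of_mem_halo hz
  obtain ⟨x, hx, hxy⟩ := exists_dist_le_of_mem_halo hy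
  refine mem_thicken.2 ⟨x, hx, ?_⟩
  push_cast
  linarith [dist_triangle x y z, (Nat.cast_nonneg n : (0 : ℝ) ≤ n)]

lemma glue_congr {Λ : Finset (Site d)} {σ ω η : Config d} {z : Site d} (h : ω z = η z) :
    glue Λ σ ω z = glue Λ σ η z := by
  simp [glue, h]

lemma energyDiff_glue_congr (k : ℤ) {Λ s : Finset (Site d)} {σ τ : Config d} {n : ℕ}
    (h : ∀ z ∈ thicken Λ (n + 3), σ z = τ z) :
    energyDiff k (glue Λ (ind s) σ) σ = energyDiff k (glue Λ (ind s) τ) τ :=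
  energyDiff_congr k (mem_fiber_comm.1 (glue_mem_fiber _ _ _))
    (mem_fiber_comm.1 (glue_mem_fiber _ _ _))
    (fun x hx => glue_congr (h x (halo_halo_subset_thicken Λ n hx)))
    fun x hx => h x (halo_halo_subset_thicken Λ n hx)

lemma abs_pot_glue_sub_le {a r ρ : ℝ} (hc : Contracts d r ρ) {Λ s : Finset (Site d)}
    {σ τ : Config d} {n : ℕ} (h : ∀ z ∈ thicken Λ (n + 3), σ z = τ z) :
    |pot a r (glue Λ (ind s) σ) σ - pot a r (glue Λ (ind s) τ) τ| ≤
      potConst d * Λ.card * ρ ^ n :=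
  abs_pot_sub_le hc n (mem_fiber_comm.1 (glue_mem_fiber _ _ _))
    (mem_fiber_comm.1 (glue_mem_fiber _ _ _)) (fun z hz => glue_congr (h z hz)) h

lemma abs_gibbs_sub_le_pow (k : ℤ) {a r ρ : ℝ} (hc : Contracts d r ρ) {Λ : Finset (Site d)}
    {σ τ : Config d} {n : ℕ} (h : ∀ z ∈ thicken Λ (n + 3), σ z = τ z) :
    |gibbs (energyDiff k) (pot a r) Λ σ - gibbs (energyDiff k) (pot a r) Λ τ| ≤
      potConst d * Λ.card * ρ ^ n :=
  abs_gibbs_sub_le (isCocycle_energyDiff k) (isCocycle_pot hc)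
    (mul_nonneg (mul_nonneg (potConst_nonneg d) (by positivity)) (pow_nonneg hc.rate_pos.le n))
    (fun _ _ => energyDiff_glue_congr k h) fun _ _ => abs_pot_glue_sub_le hc h

lemma eventually_eq_on {ι : Type*} {l : Filter ι} {ζ : ι → Config d} {σ : Config d}
    (h : Tendsto ζ l (𝓝 σ)) (T : Finset (Site d)) : ∀ᶠ i in l, ∀ z ∈ T, ζ i z = σ z := by
  rw [Filter.eventually_all_finset]
  intro z _
  have := tendsto_pi_nhds.1 h z
  rwa [nhds_discrete, tendsto_pure] at this

lemma continuous_gibbs (k : ℤ) {a r ρ : ℝ} (hc : Contracts d r ρ) (Λ : Finset (Site d)) :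
    Continuous (gibbs (energyDiff k) (pot a r) Λ) := by
  refine continuous_iff_continuousAt.2 fun σ => Metric.tendsto_nhds.2 fun ε hε => ?_
  obtain ⟨n, hn⟩ := exists_mul_pow_lt hc.rate_pos hc.rate_lt_one (potConst d * Λ.card) hε
  filter_upwards [eventually_eq_on tendsto_id (thicken Λ (n + 3))] with τ hτ
  exact (abs_gibbs_sub_le_pow k hc hτ).trans_lt hn

/-- The relative potential in the finite volume `B`. -/
noncomputable def finPotDiff (a r : ℝ) (B : Finset (Site d)) (σ τ : Config d) : ℝ :=
  finPot a r B σ - finPot a r B τ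

lemma isCocycle_finPotDiff (a r : ℝ) (B : Finset (Site d)) : IsCocycle (finPotDiff a r B) :=
  fun _ _ _ _ _ _ => by simp [finPotDiff]

/-- The configuration moves together with the box because the DLR limit evaluates the weights at
`truncProj B ω`. -/
lemma tendsto_gibbs_finPotDiff (k : ℤ) {a r ρ : ℝ} (hc : Contracts d r ρ) (Λ : Finset (Site d))
    {ζ : Finset (Site d) → Config d} {σ : Config d} (hζ : Tendsto ζ atTop (𝓝 σ)) :
    Tendsto (fun B => gibbs (energyDiff k) (finPotDiff a r B) Λ (ζ B)) atTop
      (𝓝 (gibbs (energyDiff k) (pot a r) Λ σ)) := by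
  refine tendsto_gibbs (isCocycle_energyDiff k) (fun s _ => ?_) fun s _ => ?_
  · filter_upwards [eventually_eq_on hζ (thicken Λ (0 + 3))] with B hB
    exact energyDiff_glue_congr k hB
  · have h1 := tendsto_finPot_sub (a := a) hc (mem_fiber_comm.1 (glue_mem_fiber Λ (ind s) σ))
    have h2 : Tendsto (fun B => finPotDiff a r B (glue Λ (ind s) (ζ B)) (ζ B) -
        (finPot a r B (glue Λ (ind s) σ) - finPot a r B σ)) atTop (𝓝 0) := by
      refine Metric.tendsto_nhds.2 fun ε hε => ?_
      obtain ⟨n, hn⟩ := exists_mul_pow_lt hc.rate_pos hc.rate_lt_one (potConst d * Λ.card) hε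
      filter_upwards [eventually_eq_on hζ (thicken Λ (n + 3)),
        eventually_ge_atTop (thicken Λ (n + 3))] with B hB hB'
      rw [Real.dist_0_eq_abs]
      refine lt_of_le_of_lt (abs_finPot_sub_sub_le hc n
        (mem_fiber_comm.1 (glue_mem_fiber _ _ _)) (mem_fiber_comm.1 (glue_mem_fiber _ _ _))
        fun x hx z hz => ?_) hn
      have := mem_thicken.2 ⟨x, hx, hz⟩
      exact ⟨hB' this, hB' this, glue_congr (hB z this), hB z this⟩
    simpa using h2.add h1

end Potential

end NonIsolates

namespace NonIsolates

/-! ### The law of the image field in a finite box -/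

section Law

open scoped Classical
open Filter Topology

variable {d : ℕ}

/-- The projection of the configuration `ω` after emptying all sites outside `B`. -/
noncomputable def truncProj (B : Finset (Site d)) (ω : Config d) : Config d :=
  proj (glue B ω (ind ∅))

lemma proj_congr {ω η : Config d} {x : Site d} (hx : ω x = η x)
    (h : ∀ y, Adj x y → ω y = η y) : proj ω x = proj η x := by
  rw [Bool.eq_iff_iff, proj_eq_true_iff, proj_eq_true_iff, hx]
  exact and_congr_right fun _ => exists_congr fun y => and_congr_right fun hy => by rw [h y hy]

lemma tendsto_truncProj (ω : Config d) :
    Tendsto (fun B => truncProj B ω) atTop (𝓝 (proj ω)) := by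
  refine tendsto_pi_nhds.2 fun x => tendsto_const_nhds.congr' ?_
  filter_upwards [eventually_ge_atTop (halo {x})] with B hB
  refine (proj_congr (glue_of_mem (hB (subset_halo _ (by simp)))) fun y hy => ?_).symm
  exact glue_of_mem (hB (mem_halo.2 (.inr ⟨x, by simp, hy⟩)))

lemma glue_ind_empty {B s : Finset (Site d)} (hs : s ⊆ B) : glue B (ind s) (ind ∅) = ind s := by
  funext x
  by_cases hx : x ∈ B
  · rw [glue_of_mem hx]
  · rw [glue_of_notMem hx]
    simpa [ind] using fun h => hx (hs h)

lemma sum_fiber_empty {M : Type*} [AddCommMonoid M] (B : Finset (Site d)) (F : Config d → M) :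
    ∑ τ ∈ fiber B (ind ∅), F τ = ∑ s ∈ B.powerset, F (ind s) := by
  rw [sum_fiber]
  exact Finset.sum_congr rfl fun s hs => by rw [glue_ind_empty (Finset.mem_powerset.1 hs)]

lemma comp_truncProj_eq (B : Finset (Site d)) (F : Config d → ℝ) (ω : Config d) :
    F (truncProj B ω) = ∑ s ∈ B.powerset,
      (pattern B (ind s)).indicator (fun _ => F (proj (ind s))) ω := by
  rw [Finset.sum_eq_single_of_mem (B.filter fun x => ω x = true) (by simp)]
  · have h : ω ∈ pattern B (ind (B.filter fun x => ω x = true)) := fun x hx => by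
      simp [ind, hx]
    rw [Set.indicator_of_mem h, truncProj]
    congr 2
    funext x
    by_cases hx : x ∈ B
    · rw [glue_of_mem hx, h x hx]
    · rw [glue_of_notMem hx]
      simp [ind, hx]
  · intro s hs hne
    refine Set.indicator_of_notMem (fun h => hne ?_) _
    ext x
    have hsB := Finset.mem_powerset.1 hs
    by_cases hx : x ∈ B
    · simp [hx, h x hx, ind]
    · simpa [hx] using fun h => hx (hsB h)

lemma measurable_comp_truncProj (B : Finset (Site d)) (F : Config d → ℝ) :
    Measurable fun ω => F (truncProj B ω) := by
  simp only [comp_truncProj_eq]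
  exact Finset.measurable_sum _ fun s _ =>
    measurable_const.indicator (measurableSet_pattern _ _)

instance (p : unitInterval) : IsProbabilityMeasure (bernoulliField d p) := by
  unfold bernoulliField; infer_instance

lemma bernoulliField_real_pattern (p : unitInterval) {B s : Finset (Site d)} (hs : s ⊆ B) :
    (bernoulliField d p).real (pattern B (ind s)) =
      (p : ℝ) ^ s.card * (1 - (p : ℝ)) ^ (B.card - s.card) := by
  have h1 : pattern B (ind s) = (B : Set (Site d)).pi fun x => {ind s x} := by
    ext; simp [pattern, Set.mem_pi]
  rw [measureReal_def, h1, bernoulliField,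
    Measure.infinitePi_pi _ fun _ _ => measurableSet_singleton _, ENNReal.toReal_prod]
  have h2 : ∀ x ∈ B, ((bernoulliMeasure true false p) {ind s x}).toReal =
      if x ∈ s then (p : ℝ) else 1 - p := by
    intro x _
    rw [← measureReal_def, bernoulliMeasure_real_apply p (measurableSet_singleton _)]
    by_cases hx : x ∈ s <;> simp [ind, hx]
  rw [Finset.prod_congr rfl h2, Finset.prod_ite, Finset.prod_const, Finset.prod_const,
    Finset.filter_mem_eq_inter, Finset.inter_eq_right.2 hs, Finset.filter_notMem_eq_sdiff,
    Finset.card_sdiff_of_subset hs]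

lemma integral_comp_truncProj (p : unitInterval) (B : Finset (Site d)) (F : Config d → ℝ) :
    ∫ ω, F (truncProj B ω) ∂bernoulliField d p = ∑ s ∈ B.powerset,
      (p : ℝ) ^ s.card * (1 - (p : ℝ)) ^ (B.card - s.card) * F (proj (ind s)) := by
  simp only [comp_truncProj_eq]
  rw [integral_finsetSum]
  · refine Finset.sum_congr rfl fun s hs => ?_
    rw [integral_indicator_const _ (measurableSet_pattern _ _),
      bernoulliField_real_pattern p (Finset.mem_powerset.1 hs), smul_eq_mul]
  · intro s _
    exact (integrable_const _).indicator (measurableSet_pattern _ _)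

/-- The non-isolated sites of a finite set. -/
noncomputable def core (s : Finset (Site d)) : Finset (Site d) :=
  s.filter fun x => ∃ y, Adj x y ∧ y ∈ s

lemma mem_core {s : Finset (Site d)} {x : Site d} : x ∈ core s ↔ x ∈ s ∧ ∃ y, Adj x y ∧ y ∈ s := by
  simp [core]

lemma proj_ind (s : Finset (Site d)) : proj (ind s) = ind (core s) := by
  funext x
  rw [Bool.eq_iff_iff, proj_eq_true_iff]
  simp [ind, mem_core]

lemma ind_mem_range_iff {t : Finset (Site d)} :
    ind t ∈ Set.range (proj : Config d → Config d) ↔ ∀ x ∈ t, ∃ y, Adj x y ∧ y ∈ t := by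
  rw [mem_range_proj_iff]
  simp [ind]

lemma mem_vacant_ind {t B : Finset (Site d)} {x : Site d} :
    x ∈ vacant (ind t) B ↔ x ∈ B ∧ x ∉ t ∧ ∀ y, Adj x y → y ∉ t := by
  simp [vacant, ind, EmptyAround]

/-- The preimages of `t` are the unions `t ∪ I` with `I` the set of erased isolates: its sites are
pairwise non-adjacent and not adjacent to `t`. -/
lemma sum_pow_card_core_eq (r : ℝ) {t B : Finset (Site d)} (htB : t ⊆ B)
    (ht : ∀ x ∈ t, ∃ y, Adj x y ∧ y ∈ t) :
    ∑ s ∈ B.powerset with core s = t, r ^ s.card =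
      r ^ t.card * hardCore r (vacant (ind t) B) := by
  unfold hardCore
  rw [Finset.mul_sum]
  have hdisj : ∀ I ∈ (vacant (ind t) B).powerset.filter Indep, Disjoint t I := by
    intro I hI
    refine Finset.disjoint_left.2 fun x hx hxI => ?_
    exact (mem_vacant_ind.1 (Finset.mem_powerset.1 (Finset.mem_filter.1 hI).1 hxI)).2.1 hx
  refine Finset.sum_nbij' (fun s => s \ t) (fun I => t ∪ I) ?_ ?_ ?_ ?_ ?_
  · intro s hs
    obtain ⟨hsB, rfl⟩ := Finset.mem_filter.1 hs
    rw [Finset.mem_powerset] at hsB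
    rw [Finset.mem_filter, Finset.mem_powerset]
    refine ⟨fun x hx => ?_, fun x hx y hy hxy => ?_⟩
    · rw [Finset.mem_sdiff] at hx
      refine mem_vacant_ind.2 ⟨hsB hx.1, hx.2, fun y hxy hy => hx.2 ?_⟩
      exact mem_core.2 ⟨hx.1, y, hxy, (mem_core.1 hy).1⟩
    · rw [Finset.mem_sdiff] at hx hy
      exact hx.2 (mem_core.2 ⟨hx.1, y, hxy, hy.1⟩)
  · intro I hI
    obtain ⟨hIv, hind⟩ := Finset.mem_filter.1 hI
    rw [Finset.mem_powerset] at hIv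
    rw [Finset.mem_filter, Finset.mem_powerset]
    refine ⟨Finset.union_subset htB fun x hx => (mem_vacant_ind.1 (hIv hx)).1, ?_⟩
    ext x
    simp only [mem_core, Finset.mem_union]
    constructor
    · rintro ⟨hx | hx, y, hxy, hy⟩
      · exact hx
      · rcases hy with hy | hy
        · exact absurd hy ((mem_vacant_ind.1 (hIv hx)).2.2 y hxy)
        · exact absurd hxy (hind x hx y hy)
    · intro hx
      obtain ⟨y, hxy, hy⟩ := ht x hx
      exact ⟨.inl hx, y, hxy, .inl hy⟩
  · intro s hs
    obtain ⟨-, rfl⟩ := Finset.mem_filter.1 hs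
    exact Finset.union_sdiff_of_subset (Finset.filter_subset _ _)
  · intro I hI
    exact Finset.union_sdiff_cancel_left (hdisj I hI)
  · intro s hs
    obtain ⟨-, rfl⟩ := Finset.mem_filter.1 hs
    have hsub : core s ⊆ s := Finset.filter_subset _ _
    rw [← pow_add, Finset.card_sdiff_of_subset hsub,
      Nat.add_sub_cancel' (Finset.card_le_card hsub)]

lemma sum_pow_card_proj_ind (r : ℝ) (B : Finset (Site d)) (F : Config d → ℝ) :
    ∑ s ∈ B.powerset, r ^ s.card * F (proj (ind s)) =
      ∑ τ ∈ fiber B (ind ∅), if τ ∈ Set.range (proj : Config d → Config d) then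
        r ^ (B.filter fun x => τ x = true).card * hardCore r (vacant τ B) * F τ else 0 := by
  rw [sum_fiber_empty, ← Finset.sum_filter,
    ← Finset.sum_fiberwise_of_maps_to (g := core) (t := B.powerset.filter fun t =>
      ind t ∈ Set.range (proj : Config d → Config d))]
  · refine Finset.sum_congr rfl fun t ht => ?_
    rw [Finset.mem_filter, Finset.mem_powerset, ind_mem_range_iff] at ht
    have h1 : (B.filter fun x => ind t x = true) = t := by
      ext x
      simp only [ind, Finset.mem_filter, decide_eq_true_eq]
      exact ⟨fun h => h.2, fun h => ⟨ht.1 h, h⟩⟩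
    rw [h1, ← sum_pow_card_core_eq r ht.1 ht.2, Finset.sum_mul]
    refine Finset.sum_congr rfl fun s hs => ?_
    rw [proj_ind, (Finset.mem_filter.1 hs).2]
  · intro s hs
    rw [Finset.mem_filter, Finset.mem_powerset]
    exact ⟨(Finset.filter_subset _ _).trans (Finset.mem_powerset.1 hs), ⟨ind s, proj_ind s⟩⟩

lemma ind_empty_mem_range : ind ∅ ∈ Set.range (proj : Config d → Config d) :=
  ind_mem_range_iff.2 (by simp)

/-- The law of the projection of the Bernoulli field in `B` is the finite-volume Gibbs distribution
with empty boundary condition. -/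
def IsGibbsLaw (d : ℕ) (p : unitInterval) (k : ℤ) (a r : ℝ) : Prop :=
  ∀ (B : Finset (Site d)) (F : Config d → ℝ), ∫ ω, F (truncProj B ω) ∂bernoulliField d p =
    gibbsAvg (energyDiff k) (finPotDiff a r B) B F (ind ∅)

lemma exp_finPot {r : ℝ} (hr : 0 < r) (B : Finset (Site d)) (σ : Config d) :
    Real.exp (finPot r r B σ) =
      r ^ (B.filter fun x => σ x = true).card * hardCore r (vacant σ B) := by
  rw [finPot, Real.exp_add, Real.exp_log (hardCore_pos hr.le _), Real.exp_nat_mul, Real.exp_log hr]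

lemma isGibbsLaw_of_pos {p : unitInterval} (h0 : 0 < (p : ℝ)) (h1 : (p : ℝ) < 1) :
    IsGibbsLaw d p 0 ((p : ℝ) / (1 - p)) ((p : ℝ) / (1 - p)) := by
  set r : ℝ := (p : ℝ) / (1 - p) with hrdef
  have hq : 0 < 1 - (p : ℝ) := by linarith
  have hr : 0 < r := by positivity
  intro B
  let W : (Config d → ℝ) → ℝ := fun F => ∑ τ ∈ fiber B (ind ∅),
    if τ ∈ Set.range (proj : Config d → Config d) then
        r ^ (B.filter fun x => τ x = true).card * hardCore r (vacant τ B) * F τ else 0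
  have hleft : ∀ F, ∫ ω, F (truncProj B ω) ∂bernoulliField d p =
      (1 - (p : ℝ)) ^ B.card * W F := by
    intro F
    rw [integral_comp_truncProj]
    simp only [W]
    rw [← sum_pow_card_proj_ind, Finset.mul_sum]
    refine Finset.sum_congr rfl fun s hs => ?_
    have hc := Finset.card_le_card (Finset.mem_powerset.1 hs)
    rw [← mul_assoc]
    congr 1
    -- The Bernoulli weight is `(1 - p) ^ |B|` times `r ^ |s|`.
    rw [hrdef, div_pow]
    nth_rewrite 2 [← Nat.sub_add_cancel hc]
    rw [pow_add]
    field_simp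
  set κ : ℝ := gibbs (energyDiff 0) (finPotDiff r r B) B (ind ∅) *
    Real.exp (-finPot r r B (ind ∅)) with hκ
  have hright : ∀ F, gibbsAvg (energyDiff 0) (finPotDiff r r B) B F (ind ∅) = κ * W F := by
    intro F
    simp only [gibbsAvg, W]
    rw [Finset.mul_sum]
    refine Finset.sum_congr rfl fun τ hτ => ?_
    rw [gibbs_of_isGround (isCocycle_energyDiff 0) (isCocycle_finPotDiff r r B)
      (isGround_zero_of_mem_range ind_empty_mem_range B) hτ, hκ]
    simp only [energyDiff_zero_eq_zero_iff ind_empty_mem_range hτ]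
    split_ifs
    · rw [← exp_finPot hr, finPotDiff, sub_eq_add_neg, Real.exp_add]
      ring
    · simp
  -- Both expectations are multiples of the same functional `W`; total mass one identifies the
  -- constants.
  have e1 : (1 - (p : ℝ)) ^ B.card * W (fun _ => 1) = 1 := by rw [← hleft]; simp
  have e2 : κ * W (fun _ => 1) = 1 := by
    rw [← hright]
    simpa [gibbsAvg] using sum_gibbs (isCocycle_energyDiff 0) (isCocycle_finPotDiff r r B) B (ind ∅)
  have hW : W (fun _ => 1) ≠ 0 := right_ne_zero_of_mul_eq_one e2
  have e3 : κ = (1 - (p : ℝ)) ^ B.card := mul_right_cancel₀ hW (e2.trans e1.symm)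
  intro F
  rw [hleft, hright, e3]

/-- At `p = 0` the field is empty, yet `exp` of a potential never vanishes. With `k = 1` every
occupied site costs energy, so the empty configuration is the unique minimizer. -/
lemma isGibbsLaw_zero : IsGibbsLaw d 0 1 1 0 := by
  intro B
  have hE0 : ∀ x, energy 1 (ind ∅ : Config d) x = 0 := fun x => by simp [energy, ind]
  have hEnn : ∀ (τ : Config d) x, 0 ≤ energy 1 τ x := fun τ x => by
    unfold energy; split_ifs <;> norm_num
  have hg : IsGround (energyDiff 1) B (ind ∅) := fun τ _ => finsum_nonneg fun x => by
    rw [hE0, sub_zero]; exact hEnn τ x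
  have hpos : ∀ τ ∈ fiber B (ind ∅), τ ≠ ind ∅ → energyDiff 1 τ (ind ∅) ≠ 0 := by
    intro τ hτ hne hz
    refine hne (funext fun x => ?_)
    rw [energyDiff_eq_sum 1 (mem_fiber_comm.1 hτ)] at hz
    simp only [hE0, sub_zero] at hz
    rw [Finset.sum_eq_zero_iff_of_nonneg fun x _ => hEnn τ x] at hz
    by_contra hx
    have hx' : τ x = true := by simpa [ind] using hx
    have hE : energy 1 τ x ≠ 0 := by
      unfold energy; rw [if_pos hx']; split_ifs <;> norm_num
    refine hE (hz x (support_energy_sub 1 (mem_fiber_comm.1 hτ) ?_))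
    simpa [hE0] using hE
  have havg : ∀ F : Config d → ℝ, gibbsAvg (energyDiff 1) (finPotDiff 1 0 B) B F (ind ∅) =
      gibbs (energyDiff 1) (finPotDiff 1 0 B) B (ind ∅) * F (ind ∅) := by
    intro F
    refine Finset.sum_eq_single_of_mem _ (self_mem_fiber _ _) fun τ hτ hne => ?_
    rw [gibbs_of_isGround (isCocycle_energyDiff 1) (isCocycle_finPotDiff _ _ B) hg hτ,
      if_neg (hpos τ hτ hne)]
    ring
  have hone : gibbs (energyDiff 1) (finPotDiff 1 0 B) B (ind ∅) = 1 := by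
    have := havg fun _ => 1
    rw [mul_one] at this
    rw [← this]
    simpa [gibbsAvg] using
      sum_gibbs (isCocycle_energyDiff 1) (isCocycle_finPotDiff 1 0 B) B (ind ∅)
  intro F
  rw [havg, hone, one_mul, integral_comp_truncProj,
    Finset.sum_eq_single_of_mem ∅ (Finset.empty_mem_powerset _)]
  · simp [proj_ind, core]
  · intro s _ hs
    simp [Finset.card_ne_zero.2 (Finset.nonempty_iff_ne_empty.2 hs)]

/-! ### The DLR equations in the infinite-volume limit -/

lemma tendsto_gibbsAvg_truncProj (k : ℤ) {a r ρ : ℝ} (hc : Contracts d r ρ) (Λ : Finset (Site d))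
    {f : Config d → ℝ} (hf : Continuous f) (ω : Config d) :
    Tendsto (fun B => gibbsAvg (energyDiff k) (finPotDiff a r B) Λ f (truncProj B ω)) atTop
      (𝓝 (gibbsAvg (energyDiff k) (pot a r) Λ f (proj ω))) := by
  unfold gibbsAvg
  simp only [sum_fiber]
  refine tendsto_finsetSum _ fun s _ => ?_
  have h := ((continuous_glue Λ (ind s)).tendsto _).comp (tendsto_truncProj ω)
  exact (tendsto_gibbs_finPotDiff k hc Λ h).mul ((hf.tendsto _).comp h)

lemma integral_gibbsAvg_proj {p : unitInterval} {k : ℤ} {a r ρ : ℝ} (hc : Contracts d r ρ)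
    (hlaw : IsGibbsLaw d p k a r) (Λ : Finset (Site d)) {f : Config d → ℝ} (hf : Continuous f)
    {M : ℝ} (hM : ∀ τ, |f τ| ≤ M) :
    ∫ ω, gibbsAvg (energyDiff k) (pot a r) Λ f (proj ω) ∂bernoulliField d p =
      ∫ ω, f (proj ω) ∂bernoulliField d p := by
  have h1 : Tendsto (fun B => ∫ ω, gibbsAvg (energyDiff k) (finPotDiff a r B) Λ f (truncProj B ω)
      ∂bernoulliField d p) atTop
      (𝓝 (∫ ω, gibbsAvg (energyDiff k) (pot a r) Λ f (proj ω) ∂bernoulliField d p)) := by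
    refine tendsto_integral_filter_of_dominated_convergence (fun _ => M)
      (.of_forall fun B => (measurable_comp_truncProj B _).aestronglyMeasurable)
      (.of_forall fun B => .of_forall fun ω => ?_) (integrable_const _)
      (.of_forall fun ω => tendsto_gibbsAvg_truncProj k hc Λ hf ω)
    exact abs_gibbsAvg_le (isCocycle_energyDiff k) (isCocycle_finPotDiff a r B) Λ hM _
  have h2 : Tendsto (fun B => ∫ ω, f (truncProj B ω) ∂bernoulliField d p) atTop
      (𝓝 (∫ ω, f (proj ω) ∂bernoulliField d p)) := by
    refine tendsto_integral_filter_of_dominated_convergence (fun _ => M)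
      (.of_forall fun B => (measurable_comp_truncProj B _).aestronglyMeasurable)
      (.of_forall fun B => .of_forall fun ω => hM _) (integrable_const _)
      (.of_forall fun ω => (hf.tendsto _).comp (tendsto_truncProj ω))
  refine tendsto_nhds_unique (h1.congr' ?_) h2
  -- Once `Λ ⊆ B`, the two integrals coincide by the finite-volume law and consistency.
  filter_upwards [eventually_ge_atTop Λ] with B hB
  rw [hlaw B, hlaw B, gibbsAvg_gibbsAvg (isCocycle_energyDiff k) (isCocycle_finPotDiff a r B) hB]

lemma measurable_gibbs (k : ℤ) {a r ρ : ℝ} (hc : Contracts d r ρ) (Λ : Finset (Site d)) :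
    Measurable (gibbs (energyDiff k) (pot a r) Λ) := (continuous_gibbs k hc Λ).measurable

/-- The specification of the image field. -/
noncomputable def imageSpec (k : ℤ) (a : ℝ) {r ρ : ℝ} (hc : Contracts d r ρ) : Specification d :=
  gibbsSpec (isCocycle_energyDiff k) (isCocycle_pot (a := a) hc) (measurable_gibbs k hc)

lemma isSpecificationFor_imageSpec {p : unitInterval} {k : ℤ} {a r ρ : ℝ}
    (hc : Contracts d r ρ) (hlaw : IsGibbsLaw d p k a r) :
    (imageSpec k a hc).IsSpecificationFor (imageField d p) := by
  intro Λ
  have := (imageSpec k a hc).isMarkovKernel Λ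
  have : IsProbabilityMeasure (imageField d p) :=
    Measure.isProbabilityMeasure_map measurable_proj.aemeasurable
  refine ext_of_forall_integral_eq_of_IsFiniteMeasure fun f => ?_
  have hcomp := Kernel.integral_comp (η := (imageSpec k a hc).ker Λ)
    (κ := Kernel.const Unit (imageField d p)) (a := ()) (f := f) (by
      rw [Kernel.comp_apply, Kernel.const_apply]
      exact f.integrable _)
  rw [Kernel.comp_apply, Kernel.const_apply] at hcomp
  rw [hcomp]
  change ∫ ω, ∫ τ, f τ ∂gibbsMeasure (energyDiff k) (pot a r) Λ ω ∂imageField d p = _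
  simp only [integral_gibbsMeasure]
  have hcont : Continuous (gibbsAvg (energyDiff k) (pot a r) Λ f) := by
    unfold gibbsAvg
    simp only [sum_fiber]
    exact continuous_finsetSum _ fun s _ =>
      ((continuous_gibbs k hc Λ).comp (continuous_glue Λ (ind s))).mul
        (f.continuous.comp (continuous_glue Λ (ind s)))
  rw [imageField, integral_map measurable_proj.aemeasurable hcont.aestronglyMeasurable,
    integral_map measurable_proj.aemeasurable f.continuous.aestronglyMeasurable]
  exact integral_gibbsAvg_proj hc hlaw Λ f.continuous fun τ => f.norm_coe_le_norm τ

/-! ### Quasilocality and the exponential rate -/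

lemma isQuasilocal_imageSpec (k : ℤ) (a : ℝ) {r ρ : ℝ} (hc : Contracts d r ρ) :
    (imageSpec k a hc).IsQuasilocal := by
  intro Λ σ
  change Continuous fun ω => gibbsMeasure (energyDiff k) (pot a r) Λ ω (pattern Λ σ)
  simp only [gibbsMeasure_pattern]
  refine ENNReal.continuous_ofReal.comp ((continuous_gibbs k hc Λ).comp ?_)
  refine continuous_pi fun x => ?_
  by_cases hx : x ∈ Λ
  · simpa [glue, hx] using continuous_const
  · simpa [glue, hx] using continuous_apply x

lemma imageSpec_real_pattern (k : ℤ) (a : ℝ) {r ρ : ℝ} (hc : Contracts d r ρ)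
    (Λ : Finset (Site d)) (σ ω : Config d) :
    ((imageSpec k a hc).ker Λ ω).real (pattern Λ σ) =
      gibbs (energyDiff k) (pot a r) Λ (glue Λ σ ω) := by
  rw [measureReal_def]
  change (gibbsMeasure (energyDiff k) (pot a r) Λ ω (pattern Λ σ)).toReal = _
  rw [gibbsMeasure_pattern, ENNReal.toReal_ofReal (gibbs_nonneg _ _)]

lemma distCompl_le {Λ Δ : Finset (Site d)} {x y : Site d} (hx : x ∈ Λ) (hy : y ∉ Δ) :
    distCompl Λ Δ ≤ dist x y :=
  csInf_le ⟨0, by rintro _ ⟨x, _, y, _, rfl⟩; exact dist_nonneg⟩ ⟨x, hx, y, hy, rfl⟩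

lemma abs_gibbs_sub_le_exp (k : ℤ) (a : ℝ) {r ρ : ℝ} (hc : Contracts d r ρ)
    {Λ Δ : Finset (Site d)} {σ τ : Config d} (h : ∀ x ∈ Δ, σ x = τ x) :
    |gibbs (energyDiff k) (pot a r) Λ σ - gibbs (energyDiff k) (pot a r) Λ τ| ≤
      (potConst d + 1) * (ρ ^ 4)⁻¹ * Λ.card * Real.exp (-(-Real.log ρ) * distCompl Λ Δ) := by
  have hρ := hc.rate_pos
  have hK := potConst_nonneg d
  -- For `Λ = ∅` the right-hand side is zero, so the trivial bound used below for short distances is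
  -- not available.
  rcases Λ.eq_empty_or_nonempty with rfl | hne
  · simpa using abs_gibbs_sub_le_pow k (a := a) hc (Λ := ∅) (σ := σ) (τ := τ) (n := 0)
      (by simp [thicken])
  have hcard : (1 : ℝ) ≤ Λ.card := by exact_mod_cast hne.card_pos
  have hexp : Real.exp (-(-Real.log ρ) * distCompl Λ Δ) = ρ ^ distCompl Λ Δ := by
    rw [neg_neg, Real.rpow_def_of_pos hρ]
  rw [hexp]
  -- At distance at most `3` the locality estimate is void; the trivial bound `1` is absorbed by `(ρ
  -- ^ 4)⁻¹` and by the `+ 1` in the constant.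
  by_cases hD : distCompl Λ Δ ≤ 3
  · have h1 : |gibbs (energyDiff k) (pot a r) Λ σ - gibbs (energyDiff k) (pot a r) Λ τ| ≤ 1 := by
      have hD := isCocycle_energyDiff (d := d) k
      have hP := isCocycle_pot (a := a) hc
      rw [abs_sub_le_iff]
      constructor <;> linarith [gibbs_nonneg (D := energyDiff k) (Φ := pot a r) Λ σ,
        gibbs_nonneg (D := energyDiff k) (Φ := pot a r) Λ τ, gibbs_le_one hD hP Λ σ,
        gibbs_le_one hD hP Λ τ]
    have h2 : ρ ^ 4 ≤ ρ ^ distCompl Λ Δ := by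
      rw [← Real.rpow_natCast]
      exact Real.rpow_le_rpow_of_exponent_ge hρ hc.rate_lt_one.le (by push_cast; linarith)
    calc _ ≤ (1 : ℝ) := h1
      _ = 1 * (ρ ^ 4)⁻¹ * 1 * ρ ^ 4 := by field_simp
      _ ≤ _ := by gcongr; linarith
  · push Not at hD
    set D := distCompl Λ Δ with hDdef
    -- With `n = ⌈D⌉₊ - 4`, `n + 3 < D` keeps the thickened volume inside `Δ`, and `D ≤ n + 4` loses
    -- only the factor `(ρ ^ 4)⁻¹`.
    have hceil : 4 ≤ ⌈D⌉₊ := Nat.lt_ceil.2 (by exact_mod_cast hD)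
    obtain ⟨n, hn⟩ := Nat.exists_eq_add_of_le hceil
    have h1 : (n : ℝ) + 3 < D := by
      have := Nat.ceil_lt_add_one (by linarith : 0 ≤ D)
      rw [hn] at this
      push_cast at this
      linarith
    have h2 : D ≤ n + 4 := by
      have := Nat.le_ceil D
      rw [hn] at this
      push_cast at this
      linarith
    have h3 : ∀ z ∈ thicken Λ (n + 3), σ z = τ z := by
      intro z hz
      obtain ⟨x, hx, hxz⟩ := mem_thicken.1 hz
      refine h z (by_contra fun hzΔ => ?_)
      have := distCompl_le hx hzΔ
      push_cast at hxz
      linarith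
    have h4 : ρ ^ (n + 4) ≤ ρ ^ D := by
      rw [← Real.rpow_natCast]
      exact Real.rpow_le_rpow_of_exponent_ge hρ hc.rate_lt_one.le (by push_cast; linarith)
    calc _ ≤ potConst d * Λ.card * ρ ^ n := abs_gibbs_sub_le_pow k hc h3
      _ = potConst d * (ρ ^ 4)⁻¹ * Λ.card * ρ ^ (n + 4) := by rw [pow_add]; field_simp
      _ ≤ _ := by gcongr; linarith

lemma contracts_of_lt {p : unitInterval} (hd : 1 ≤ d) (hp : (p : ℝ) < 1 / (2 * (d : ℝ))) :
    (p : ℝ) < 1 ∧ ∃ ρ, Contracts d ((p : ℝ) / (1 - p)) ρ := by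
  have hd' : (1 : ℝ) ≤ d := by exact_mod_cast hd
  have hp0 : 0 ≤ (p : ℝ) := p.2.1
  rw [lt_div_iff₀ (by positivity)] at hp
  have hp1 : (p : ℝ) < 1 := by nlinarith
  have hq : 0 < 1 - (p : ℝ) := by linarith
  have h1 : (2 * d - 1) * ((p : ℝ) / (1 - p)) < 1 := by
    rw [mul_div_assoc', div_lt_one hq]
    linarith
  have h0 : 0 ≤ (p : ℝ) / (1 - p) := by positivity
  -- The maximum with `1 / 2` keeps the rate positive at `p = 0`, so that `-Real.log ρ` is a genuine
  -- decay rate.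
  refine ⟨hp1, max ((2 * d - 1) * ((p : ℝ) / (1 - p))) (1 / 2), h0, ?_, ?_, ?_, le_max_left _ _⟩
  · nlinarith
  · exact lt_max_of_lt_right (by norm_num)
  · exact max_lt h1 (by norm_num)

lemma exists_isGibbsLaw {p : unitInterval} (hd : 1 ≤ d) (hp : (p : ℝ) < 1 / (2 * (d : ℝ))) :
    ∃ (k : ℤ) (a r ρ : ℝ), 0 ≤ k ∧ k < 2 ∧ Contracts d r ρ ∧ IsGibbsLaw d p k a r := by
  obtain ⟨hp1, ρ, hc⟩ := contracts_of_lt hd hp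
  rcases p.2.1.eq_or_lt with h0 | h0
  · obtain rfl : p = 0 := Subtype.ext h0.symm
    refine ⟨1, 1, 0, ρ, by norm_num, by norm_num, ?_, isGibbsLaw_zero⟩
    simpa using hc
  · exact ⟨0, _, _, ρ, le_rfl, by norm_num, hc, isGibbsLaw_of_pos h0 hp1⟩

end Law

end NonIsolates

open NonIsolates
theorem theorem2 (d : ℕ) (hd : 1 ≤ d) (p : unitInterval) (hp : (p : ℝ) < 1 / (2 * (d : ℝ))) :
    ∃ γ : Specification d,
      γ.IsSpecificationFor (imageField d p) ∧
      γ.IsQuasilocal ∧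
      (∀ (Λ : Finset (Site d)) (ω : Config d), ω ∈ Set.range (proj : Config d → Config d) →
        ∀ᵐ τ ∂(γ.ker Λ ω), τ ∈ Set.range (proj : Config d → Config d)) ∧
      ∃ C c : ℝ, 0 < C ∧ 0 < c ∧
        ∀ (Λ Δ : Finset (Site d)), Λ ⊆ Δ →
          ∀ ω η : Config d, (∀ x ∈ Δ, ω x = η x) →
            ∀ σ : Config d,
              |(γ.ker Λ ω).real (pattern Λ σ) - (γ.ker Λ η).real (pattern Λ σ)|
                ≤ C * (Λ.card : ℝ) * Real.exp (-c * distCompl Λ Δ) := by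
  obtain ⟨k, a, r, ρ, hk0, hk, hc, hlaw⟩ := exists_isGibbsLaw hd hp
  have hρ := hc.rate_pos
  refine ⟨imageSpec k a hc, isSpecificationFor_imageSpec hc hlaw, isQuasilocal_imageSpec k a hc,
    fun Λ ω hω => ae_gibbsMeasure fun τ hτ hg => hg.mem_range hk0 hk hω hτ,
    (potConst d + 1) * (ρ ^ 4)⁻¹, -Real.log ρ, ?_, ?_, ?_⟩
  · have := potConst_nonneg d
    positivity
  · exact neg_pos.2 (Real.log_neg hρ hc.rate_lt_one)
  · intro Λ Δ _ ω η h σ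
    rw [imageSpec_real_pattern, imageSpec_real_pattern]
    exact abs_gibbs_sub_le_exp k a hc fun x hx => glue_congr (h x hx)
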